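/- Graphs are finite and may have loops and parallel edges. For a graph $G$ and $X\subseteq E(G)$ let $G\langle X\rangle$ be the subgraph with edge set $X$ whose vertices are the ends of the edges in $X$, and let $\Delta(G)=|E(G)|-|V(G)|$. For $k\ge 1$, the *$k$-circular matroid* $M_k(G)$ is the matroid on $E(G)$ whose circuits are the sets $C\subseteq E(G)$ such that $\Delta(G\langle C\rangle)=k$ and $G\langle C\rangle$ has no isolated vertices, no leaves (vertices of degree $1$, a loop contributing $2$ to the degree) and no component that is a cycle (a loop and a pair of parallel edges being cycles). Let $\rho^*_k(G)$ be the corank of $M_k(G)$, i.e. the rank of its dual, and let $s(x,G)$ be the number of edges incident to the vertex $x$. The vertex $x$ is *$k$-small* if $s(x,G)<\rho^*_k(G)+1$ and *$k$-tight* if $s(x,G)=\rho^*_k(G)+1$. Graphs $G$, $G'$ with the same edge set are *strongly isomorphic* if there is a bijection $\nu:V(G)\to V(G')$ such that an edge has ends $x,y$ in $G$ if and only if it has ends $\nu(x),\nu(y)$ in $G'$. The graph $G$ is *uniquely defined by* $M_k(G)$ if every graph $G'$ without isolated vertices such that $M_k(G')=M_k(G)$ is strongly isomorphic to $G$. **Theorem.**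 Let $k\ge 1$ and let $G$ be a $3$-connected graph, i.e. $G$ has no loops (parallel edges are allowed), has at least four vertices, and stays connected after deletion of any at most two vertices. Then the following are equivalent: (c1) $G$ is uniquely defined by $M_k(G)$; (c2) $|E(G)|-|V(G)|\ge k$, and either every vertex of $G$ is $k$-small, or there is a $k$-tight vertex $t$ of $G$ such that every other vertex of $G$ is $k$-small. -/

import Mathlib

open Graph

universe u v

namespace KCircular

variable {α : Type u} {β : Type v}

/-- The subgraph `G⟨X⟩` induced by a set `X` of edges: its edges are those in `X`, its vertices are
the ends of the edges in `X`. -/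
def edgeInduce (G : Graph α β) (X : Set β) : Graph α β where
  vertexSet := {x | ∃ e ∈ X, G.Inc e x}
  edgeSet := E(G) ∩ X
  IsLink e x y := e ∈ X ∧ G.IsLink e x y
  isLink_symm _ _ := ⟨fun _ _ h => ⟨h.1, h.2.symm⟩⟩
  eq_or_eq_of_isLink_of_isLink _ _ _ _ _ h h' := h.2.left_eq_or_eq h'.2
  edge_mem_iff_exists_isLink e :=
    ⟨fun h => by
      obtain ⟨x, y, hxy⟩ := G.exists_isLink_of_mem_edgeSet h.1
      exact ⟨x, y, h.2, hxy⟩,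
    fun ⟨_, _, h⟩ => ⟨h.2.edge_mem, h.1⟩⟩
  left_mem_of_isLink _ _ _ h := ⟨_, h.1, h.2.inc_left⟩

/-- `Δ(G) = |E(G)| - |V(G)|` (for a finite graph). -/
noncomputable def excess (G : Graph α β) : ℤ := (E(G).ncard : ℤ) - (V(G).ncard : ℤ)

/-- The degree of a vertex, where a loop counts twice. -/
noncomputable def deg (G : Graph α β) (x : α) : ℕ := (G.incidenceSet x).ncard + (G.loopSet x).ncard

/-- Every vertex is incident to an edge. -/
def NoIsolatedVertex (G : Graph α β) : Prop := ∀ x ∈ V(G), ∃ e, G.Inc e x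

/-- A leaf is a vertex of degree one. -/
def NoLeaf (G : Graph α β) : Prop := ∀ x ∈ V(G), deg G x ≠ 1

/-- A graph is connected if it is nonempty and any two vertices are joined by a path; loops and
parallel edges are irrelevant, so this is connectedness of the underlying simple graph. -/
def IsConnected (G : Graph α β) : Prop := G.toSimpleGraph.Connected

/-- A cycle (possibly with one or two vertices): a finite connected graph all of whose vertices
have degree two. -/
def IsCycleGraph (G : Graph α β) : Prop :=
  V(G).Finite ∧ IsConnected G ∧ ∀ x ∈ V(G), deg G x = 2

/-- No component is a cycle. (`H ≤c G` says that `H` is a union of components of `G`, so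
a connected such `H` is a component.) -/
def NoCycleComponent (G : Graph α β) : Prop := ∀ H : Graph α β, H ≤c G → ¬ IsCycleGraph H

/-- Cacti-graphs: no isolated vertices, no leaves, no cycle components. -/
def IsCactiGraph (G : Graph α β) : Prop :=
  NoIsolatedVertex G ∧ NoLeaf G ∧ NoCycleComponent G

/-- The family `C_k(G)` of the edge sets `C` such that `Δ(G⟨C⟩) = k` and `G⟨C⟩` is a
cacti-graph. -/
def kCircuits (G : Graph α β) (k : ℕ) : Set (Set β) :=
  {C | C ⊆ E(G) ∧ excess (edgeInduce G C) = k ∧ IsCactiGraph (edgeInduce G C)}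

/-! Auxiliary facts: `C_k(G)` is the family of circuits of a matroid. -/

theorem edgeInduce_inc {G : Graph α β} {X : Set β} {e : β} {x : α} :
    (edgeInduce G X).Inc e x ↔ e ∈ X ∧ G.Inc e x :=
  ⟨fun ⟨y, h⟩ => ⟨h.1, y, h.2⟩, fun ⟨h, y, hy⟩ => ⟨y, h, hy⟩⟩

theorem mem_vertexSet_edgeInduce {G : Graph α β} {X : Set β} {x : α} :
    x ∈ V(edgeInduce G X) ↔ ∃ e ∈ X, G.Inc e x := Iff.rfl

theorem edgeSet_edgeInduce {G : Graph α β} {X : Set β} (hX : X ⊆ E(G)) :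
    E(edgeInduce G X) = X := Set.inter_eq_right.2 hX

theorem ends_finite (G : Graph α β) (e : β) : {x | G.Inc e x}.Finite := by
  by_cases he : e ∈ E(G)
  · obtain ⟨x, y, h⟩ := G.exists_isLink_of_mem_edgeSet he
    refine (Set.toFinite {x, y}).subset fun z hz => ?_
    simpa using Graph.Inc.eq_or_eq_of_isLink hz h
  · convert Set.finite_empty
    ext x
    simpa using fun h : G.Inc e x => he h.edge_mem

theorem vertexSet_edgeInduce_finite (G : Graph α β) {X : Set β} (hX : X.Finite) :
    V(edgeInduce G X).Finite := by
  have : V(edgeInduce G X) = ⋃ e ∈ X, {x | G.Inc e x} := by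
    ext x; simp [mem_vertexSet_edgeInduce]
  rw [this]
  exact hX.biUnion fun e _ => ends_finite G e

theorem vertexSet_edgeInduce_mono (G : Graph α β) {X Y : Set β} (h : X ⊆ Y) :
    V(edgeInduce G X) ⊆ V(edgeInduce G Y) := fun _ ⟨e, he, hx⟩ => ⟨e, h he, hx⟩

theorem vertexSet_edgeInduce_union (G : Graph α β) (X Y : Set β) :
    V(edgeInduce G (X ∪ Y)) = V(edgeInduce G X) ∪ V(edgeInduce G Y) := by
  ext x
  simp only [mem_vertexSet_edgeInduce, Set.mem_union]
  constructor
  · rintro ⟨e, he | he, hx⟩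
    exacts [Or.inl ⟨e, he, hx⟩, Or.inr ⟨e, he, hx⟩]
  · rintro (⟨e, he, hx⟩ | ⟨e, he, hx⟩)
    exacts [⟨e, Or.inl he, hx⟩, ⟨e, Or.inr he, hx⟩]

theorem excess_edgeInduce {G : Graph α β} {X : Set β} (hX : X ⊆ E(G)) :
    excess (edgeInduce G X) = (X.ncard : ℤ) - (V(edgeInduce G X).ncard : ℤ) := by
  rw [excess, edgeSet_edgeInduce hX]

theorem excess_supermodular {G : Graph α β} (hE : E(G).Finite) {X Y : Set β} (hX : X ⊆ E(G))
    (hY : Y ⊆ E(G)) :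
    excess (edgeInduce G X) + excess (edgeInduce G Y) ≤
      excess (edgeInduce G (X ∪ Y)) + excess (edgeInduce G (X ∩ Y)) := by
  have fX := hE.subset hX
  have fY := hE.subset hY
  rw [excess_edgeInduce hX, excess_edgeInduce hY, excess_edgeInduce (Set.union_subset hX hY),
    excess_edgeInduce (Set.inter_subset_left.trans hX), vertexSet_edgeInduce_union]
  have h1 := Set.ncard_union_add_ncard_inter X Y fX fY
  have h2 := Set.ncard_union_add_ncard_inter V(edgeInduce G X) V(edgeInduce G Y)
    (vertexSet_edgeInduce_finite G fX) (vertexSet_edgeInduce_finite G fY)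
  have h3 : V(edgeInduce G (X ∩ Y)).ncard ≤ (V(edgeInduce G X) ∩ V(edgeInduce G Y)).ncard :=
    Set.ncard_le_ncard (Set.subset_inter (vertexSet_edgeInduce_mono G Set.inter_subset_left)
      (vertexSet_edgeInduce_mono G Set.inter_subset_right))
      ((vertexSet_edgeInduce_finite G fX).inter_of_left _)
  omega

open Classical in
/-- Double counting of the incidences between a set of vertices and the edges. -/
theorem sum_deg {H : Graph α β} (hE : E(H).Finite) (N : Finset α) :
    ∑ x ∈ N, deg H x = ∑ e ∈ hE.toFinset,
      ((N.filter fun x => H.Inc e x).card + (N.filter fun x => H.IsLoopAt e x).card) := by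
  have h1 : ∀ x, (H.incidenceSet x).ncard = (hE.toFinset.filter fun e => H.Inc e x).card := by
    intro x
    rw [← Set.ncard_coe_finset]
    congr 1
    ext e
    simpa using fun h : H.Inc e x => h.edge_mem
  have h2 : ∀ x, (H.loopSet x).ncard = (hE.toFinset.filter fun e => H.IsLoopAt e x).card := by
    intro x
    rw [← Set.ncard_coe_finset]
    congr 1
    ext e
    simpa using fun h : H.IsLoopAt e x => h.edge_mem
  simp only [deg, h1, h2, Finset.sum_add_distrib]
  congr 1 <;> exact Finset.sum_card_bipartiteAbove_eq_sum_card_bipartiteBelow _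

open Classical in
theorem ends_count_le {H : Graph α β} (N : Finset α) {e : β} (he : e ∈ E(H)) :
    (N.filter fun x => H.Inc e x).card + (N.filter fun x => H.IsLoopAt e x).card ≤ 2 := by
  obtain ⟨x, y, h⟩ := H.exists_isLink_of_mem_edgeSet he
  by_cases hxy : x = y
  · subst hxy
    have h1 : (N.filter fun z => H.Inc e z) ⊆ {x} := fun z hz => by
      have := (Finset.mem_filter.1 hz).2.eq_or_eq_of_isLink h
      simpa using this
    have h2 : (N.filter fun z => H.IsLoopAt e z) ⊆ {x} := fun z hz => by
      have := (Finset.mem_filter.1 hz).2.inc.eq_or_eq_of_isLink h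
      simpa using this
    have := Finset.card_le_card h1
    have := Finset.card_le_card h2
    simp at *
    omega
  · have h1 : (N.filter fun z => H.Inc e z) ⊆ {x, y} := fun z hz => by
      have := (Finset.mem_filter.1 hz).2.eq_or_eq_of_isLink h
      simpa using this
    have h2 : (N.filter fun z => H.IsLoopAt e z) = ∅ := by
      refine Finset.filter_eq_empty_iff.2 fun z _ hz => hxy ?_
      rw [← hz.eq_of_inc h.inc_left, ← hz.eq_of_inc h.inc_right]
    have := (Finset.card_le_card h1).trans Finset.card_le_two
    rw [h2]
    simpa using this

open Classical in
theorem ends_count_lt {H : Graph α β} (N : Finset α) {e : β} {z : α} (hz : H.Inc e z)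
    (hzN : z ∉ N) :
    (N.filter fun x => H.Inc e x).card + (N.filter fun x => H.IsLoopAt e x).card < 2 := by
  obtain ⟨y, h⟩ := hz
  have h1 : (N.filter fun x => H.Inc e x) ⊆ {y} := fun x hx => by
    rw [Finset.mem_filter] at hx
    rcases hx.2.eq_or_eq_of_isLink h with rfl | rfl
    · exact absurd hx.1 hzN
    · simp
  have h2 : (N.filter fun x => H.IsLoopAt e x) = ∅ := by
    refine Finset.filter_eq_empty_iff.2 fun x hx hl => hzN ?_
    rwa [← hl.eq_of_inc h.inc_left]
  have := Finset.card_le_card h1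
  rw [h2]
  simp at *
  omega

open Classical in
theorem ends_count_eq {H : Graph α β} (N : Finset α) {e : β} (he : e ∈ E(H))
    (hN : ∀ x, H.Inc e x → x ∈ N) :
    2 ≤ (N.filter fun x => H.Inc e x).card + (N.filter fun x => H.IsLoopAt e x).card := by
  obtain ⟨x, y, h⟩ := H.exists_isLink_of_mem_edgeSet he
  by_cases hxy : x = y
  · subst hxy
    have h1 : 0 < (N.filter fun z => H.Inc e z).card :=
      Finset.card_pos.2 ⟨x, Finset.mem_filter.2 ⟨hN x h.inc_left, h.inc_left⟩⟩
    have h2 : 0 < (N.filter fun z => H.IsLoopAt e z).card :=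
      Finset.card_pos.2 ⟨x, Finset.mem_filter.2 ⟨hN x h.inc_left, h⟩⟩
    omega
  · have h1 : ({x, y} : Finset α) ⊆ N.filter fun z => H.Inc e z := by
      intro z hz
      simp only [Finset.mem_insert, Finset.mem_singleton] at hz
      rcases hz with rfl | rfl
      · exact Finset.mem_filter.2 ⟨hN _ h.inc_left, h.inc_left⟩
      · exact Finset.mem_filter.2 ⟨hN _ h.inc_right, h.inc_right⟩
    have := Finset.card_le_card h1
    rw [Finset.card_pair hxy] at this
    omega

theorem excess_cycle {H : Graph α β} (hH : IsCycleGraph H) (hE : E(H).Finite) :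
    E(H).ncard ≤ V(H).ncard := by
  classical
  obtain ⟨hV, -, hd⟩ := hH
  have h := sum_deg hE hV.toFinset
  rw [Finset.sum_congr rfl (fun x hx => hd x (by simpa using hx))] at h
  have h2 : ∑ e ∈ hE.toFinset, 2 ≤ ∑ e ∈ hE.toFinset,
      ((hV.toFinset.filter fun x => H.Inc e x).card +
        (hV.toFinset.filter fun x => H.IsLoopAt e x).card) :=
    Finset.sum_le_sum fun e he => ends_count_eq _ (by simpa using he)
      fun x hx => by simpa using hx.vertex_mem
  rw [← h] at h2
  simp only [Finset.sum_const, smul_eq_mul] at h2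
  rw [Set.ncard_eq_toFinset_card _ hE, Set.ncard_eq_toFinset_card _ hV]
  omega

/-- Every edge set `X` with `Δ(G⟨X⟩) ≥ k` contains a member of `C_k(G)`. -/
theorem exists_mem_kCircuits {G : Graph α β} (hE : E(G).Finite) {k : ℕ} (hk : 1 ≤ k) {X : Set β}
    (hX : X ⊆ E(G)) (hd : (k : ℤ) ≤ excess (edgeInduce G X)) : ∃ C ∈ kCircuits G k, C ⊆ X := by
  have hfin : {Y : Set β | Y ⊆ X ∧ (k : ℤ) ≤ excess (edgeInduce G Y)}.Finite :=
    (hE.subset hX).finite_subsets.subset fun Y hY => hY.1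
  obtain ⟨C, hCmin⟩ := hfin.exists_minimal ⟨X, subset_rfl, hd⟩
  have hCX := hCmin.prop.1
  have hCd := hCmin.prop.2
  have hCE := hCX.trans hX
  have fC := hE.subset hCE
  have fV := vertexSet_edgeInduce_finite G fC
  have key : ∀ D : Set β, D ⊆ C → D ≠ C → excess (edgeInduce G D) < k := by
    intro D hD hne
    by_contra hcon
    exact hne (hD.antisymm (hCmin.2 ⟨hD.trans hCX, not_lt.1 hcon⟩ hD))
  refine ⟨C, ⟨hCE, ?_, ?_, ?_, ?_⟩, hCX⟩
  · rw [excess_edgeInduce hCE] at hCd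
    have hne : C.Nonempty := by
      by_contra h
      rw [Set.not_nonempty_iff_eq_empty] at h
      subst h
      simp at hCd
      omega
    obtain ⟨e, he⟩ := hne
    have h1 := key (C \ {e}) Set.sdiff_subset (fun h => by
      have : e ∈ C \ {e} := by rw [h]; exact he
      exact this.2 rfl)
    rw [excess_edgeInduce (Set.sdiff_subset.trans hCE)] at h1
    have h2 := Set.ncard_sdiff_singleton_add_one he fC
    have h3 := Set.ncard_le_ncard (vertexSet_edgeInduce_mono G (Set.sdiff_subset (s := C) (t := {e}))) fV
    rw [excess_edgeInduce hCE]
    omega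
  · rintro x ⟨e, he, hx⟩
    exact ⟨e, edgeInduce_inc.2 ⟨he, hx⟩⟩
  · intro x hxV hx
    have hsub : (edgeInduce G C).loopSet x ⊆ (edgeInduce G C).incidenceSet x :=
      fun _ h => ⟨x, h⟩
    have hincC : (edgeInduce G C).incidenceSet x ⊆ C := fun e he => (edgeInduce_inc.1 he).1
    have h0 := Set.ncard_le_ncard hsub (fC.subset hincC)
    have h1 : ((edgeInduce G C).incidenceSet x).ncard = 1 := by
      unfold deg at hx
      omega
    obtain ⟨e, he⟩ := Set.ncard_eq_one.1 h1
    have heC : e ∈ C := hincC (by rw [he]; rfl)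
    have h1 := key (C \ {e}) Set.sdiff_subset (fun h => by
      have : e ∈ C \ {e} := by rw [h]; exact heC
      exact this.2 rfl)
    rw [excess_edgeInduce (Set.sdiff_subset.trans hCE)] at h1
    rw [excess_edgeInduce hCE] at hCd
    have h2 := Set.ncard_sdiff_singleton_add_one heC fC
    have h3 : V(edgeInduce G (C \ {e})) ⊆ V(edgeInduce G C) \ {x} := by
      rintro y ⟨f, hf, hy⟩
      refine ⟨⟨f, hf.1, hy⟩, ?_⟩
      rintro rfl
      have : f ∈ (edgeInduce G C).incidenceSet y := edgeInduce_inc.2 ⟨hf.1, hy⟩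
      rw [he] at this
      exact hf.2 this
    have h4 := Set.ncard_le_ncard h3 (fV.subset Set.sdiff_subset)
    have h5 := Set.ncard_sdiff_singleton_add_one hxV fV
    omega
  · intro H hHc hcyc
    have hHE : E(H) ⊆ C := fun e he => (hHc.le.edgeSet_mono he).2
    have fH := fC.subset hHE
    have hVE := excess_cycle hcyc fH
    have hVC : V(H) ⊆ V(edgeInduce G C) := hHc.le.vertexSet_mono
    obtain ⟨-, hconn, -⟩ := hcyc
    obtain ⟨x, hx⟩ := hconn.nonempty
    have hne : ∃ e ∈ C, e ∈ E(H) := by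
      obtain ⟨e, he, hex⟩ := hVC hx
      exact ⟨e, he, hHc.closed (edgeInduce_inc.2 ⟨he, hex⟩) hx⟩
    obtain ⟨e, heC, heH⟩ := hne
    have h1 := key (C \ E(H)) Set.sdiff_subset (fun h => by
      have : e ∈ C \ E(H) := by rw [h]; exact heC
      exact this.2 heH)
    rw [excess_edgeInduce (Set.sdiff_subset.trans hCE)] at h1
    rw [excess_edgeInduce hCE] at hCd
    have h3 : V(edgeInduce G (C \ E(H))) ⊆ V(edgeInduce G C) \ V(H) := by
      rintro y ⟨f, hf, hy⟩
      exact ⟨⟨f, hf.1, hy⟩, fun hyH => hf.2 (hHc.closed (edgeInduce_inc.2 ⟨hf.1, hy⟩) hyH)⟩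
    have h4 := Set.ncard_le_ncard h3 (fV.subset Set.sdiff_subset)
    have h5 := Set.ncard_sdiff_add_ncard_of_subset hVC fV
    have h6 := Set.ncard_sdiff_add_ncard_of_subset hHE fC
    omega

/-- In a finite cacti-graph, proper edge subsets have smaller excess. -/
theorem excess_lt_of_ssubset {G : Graph α β} (hE : E(G).Finite) {C D : Set β} (hCE : C ⊆ E(G))
    (hC : IsCactiGraph (edgeInduce G C)) (hDC : D ⊂ C) :
    excess (edgeInduce G D) < excess (edgeInduce G C) := by
  classical
  have fC := hE.subset hCE
  have fV := vertexSet_edgeInduce_finite G fC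
  have fEC : E(edgeInduce G C).Finite := by rw [edgeSet_edgeInduce hCE]; exact fC
  rw [excess_edgeInduce hCE, excess_edgeInduce (hDC.1.trans hCE)]
  have hVV := vertexSet_edgeInduce_mono G hDC.1
  have h5 := Set.ncard_sdiff_add_ncard_of_subset hVV fV
  have h6 := Set.ncard_sdiff_add_ncard_of_subset hDC.1 fC
  suffices h : (V(edgeInduce G C) \ V(edgeInduce G D)).ncard < (C \ D).ncard by omega
  by_contra hcon
  rw [not_lt] at hcon
  have fN : (V(edgeInduce G C) \ V(edgeInduce G D)).Finite := fV.subset Set.sdiff_subset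
  have fZ : (C \ D).Finite := fC.subset Set.sdiff_subset
  rw [Set.ncard_eq_toFinset_card _ fN, Set.ncard_eq_toFinset_card _ fZ] at hcon
  set N := fN.toFinset with hN
  set Z := fZ.toFinset with hZ
  have memN : ∀ x, x ∈ N ↔ x ∈ V(edgeInduce G C) ∧ x ∉ V(edgeInduce G D) := fun x => by
    simp [hN]
  have memZ : ∀ e, e ∈ Z ↔ e ∈ C ∧ e ∉ D := fun e => by simp [hZ]
  have incZ : ∀ x ∈ N, ∀ e, (edgeInduce G C).Inc e x → e ∈ Z := by
    intro x hx e he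
    rw [memZ]
    refine ⟨(edgeInduce_inc.1 he).1, fun heD => ?_⟩
    exact ((memN x).1 hx).2 ⟨e, heD, (edgeInduce_inc.1 he).2⟩
  have hdeg : ∀ x ∈ N, 2 ≤ deg (edgeInduce G C) x := by
    intro x hx
    have hxV := ((memN x).1 hx).1
    obtain ⟨e, he⟩ := hC.1 x hxV
    have h1 : 0 < ((edgeInduce G C).incidenceSet x).ncard :=
      (Set.ncard_pos (fC.subset fun f hf => (edgeInduce_inc.1 hf).1)).2 ⟨e, he⟩
    have h2 := hC.2.1 x hxV
    unfold deg at *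
    omega
  have hsum := sum_deg fEC N
  have hZE : Z ⊆ fEC.toFinset := by
    intro e he
    rw [Set.Finite.mem_toFinset, edgeSet_edgeInduce hCE]
    exact ((memZ e).1 he).1
  rw [← Finset.sum_subset hZE (fun e _ heZ => by
    rw [Finset.filter_eq_empty_iff.2 (fun x hx hi => heZ (incZ x hx e hi)),
      Finset.filter_eq_empty_iff.2 (fun x hx hi => heZ (incZ x hx e hi.inc))]
    rfl)] at hsum
  have hw : ∀ e ∈ Z, ((N.filter fun x => (edgeInduce G C).Inc e x).card +
      (N.filter fun x => (edgeInduce G C).IsLoopAt e x).card) ≤ 2 := fun e he =>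
    ends_count_le N (by rw [edgeSet_edgeInduce hCE]; exact ((memZ e).1 he).1)
  have hs1 : ∑ x ∈ N, 2 ≤ ∑ x ∈ N, deg (edgeInduce G C) x := Finset.sum_le_sum hdeg
  have hs2 := Finset.sum_le_sum hw
  have hs3 : ∑ e ∈ Z, 2 ≤ ∑ x ∈ N, 2 := by
    simp only [Finset.sum_const, smul_eq_mul]
    omega
  have hdeg2 : ∀ x ∈ N, 2 = deg (edgeInduce G C) x :=
    (Finset.sum_eq_sum_iff_of_le hdeg).1 (by omega)
  have hw2 := (Finset.sum_eq_sum_iff_of_le hw).1 (by omega)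
  have hends : ∀ e ∈ Z, ∀ x, (edgeInduce G C).Inc e x → x ∈ N := by
    intro e he x hx
    by_contra hxN
    have := ends_count_lt N hx hxN
    have := hw2 e he
    omega
  obtain ⟨e₀, he₀C, he₀D⟩ := Set.exists_of_ssubset hDC
  obtain ⟨x₀, y₀, hxy₀⟩ := G.exists_isLink_of_mem_edgeSet (hCE he₀C)
  have hx₀ : x₀ ∈ N := hends e₀ ((memZ e₀).2 ⟨he₀C, he₀D⟩) x₀
    (edgeInduce_inc.2 ⟨he₀C, hxy₀.inc_left⟩)
  set R : Set α := {y | Relation.ReflTransGen (edgeInduce G C).Adj x₀ y} with hR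
  have hRN : ∀ y ∈ R, y ∈ N := by
    intro y hy
    induction hy with
    | refl => exact hx₀
    | tail _ hbc ih =>
      obtain ⟨e, he⟩ := hbc
      exact hends e (incZ _ ih e he.inc_left) _ he.inc_right
  have hRV : R ⊆ V(edgeInduce G C) := fun y hy => ((memN y).1 (hRN y hy)).1
  have hclosed : (edgeInduce G C).induce R ≤c edgeInduce G C := by
    refine Graph.IsClosedSubgraph.mk' (Graph.induce_le hRV) ?_
    rintro e x ⟨y, hxy⟩ hx
    have hxR : x ∈ R := hx
    have hyR : y ∈ R := Relation.ReflTransGen.tail hxR ⟨e, hxy⟩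
    exact Graph.IsLink.edge_mem (G := (edgeInduce G C).induce R) ⟨hxy, hxR, hyR⟩
  refine hC.2.2 _ hclosed ⟨fN.subset fun y hy => by simpa [hN] using hRN y hy, ?_, ?_⟩
  · have hreach : ∀ y (hy : y ∈ R), ((edgeInduce G C).induce R).toSimpleGraph.Reachable
        ⟨x₀, Relation.ReflTransGen.refl⟩ ⟨y, hy⟩ := by
      intro y hy
      induction hy with
      | refl => exact SimpleGraph.Reachable.refl _
      | @tail b c hb hbc ih =>
        refine ih.trans ?_
        by_cases hne : b = c
        · subst hne
          exact SimpleGraph.Reachable.refl _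
        · refine SimpleGraph.Adj.reachable ⟨fun h => hne (congrArg Subtype.val h), ?_⟩
          obtain ⟨e, he⟩ := hbc
          exact ⟨e, he, hb, Relation.ReflTransGen.tail hb ⟨e, he⟩⟩
    have : Nonempty V((edgeInduce G C).induce R) := ⟨⟨x₀, Relation.ReflTransGen.refl⟩⟩
    exact SimpleGraph.Connected.mk fun a b => (hreach a.1 a.2).symm.trans (hreach b.1 b.2)
  · intro x hx
    rw [hdeg2 x (hRN x hx)]
    have h1 : ((edgeInduce G C).induce R).incidenceSet x = (edgeInduce G C).incidenceSet x := by
      ext e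
      exact hclosed.inc_congr hx
    have h2 : ((edgeInduce G C).induce R).loopSet x = (edgeInduce G C).loopSet x := by
      ext e
      exact hclosed.isLink_congr hx
    rw [deg, deg, h1, h2]

/-- A set of edges is independent if it contains no member of `C_k(G)`. -/
def KIndep (G : Graph α β) (k : ℕ) (I : Set β) : Prop :=
  I ⊆ E(G) ∧ ∀ C ∈ kCircuits G k, ¬ C ⊆ I

theorem kIndep_iff {G : Graph α β} (hE : E(G).Finite) {k : ℕ} (hk : 1 ≤ k) {I : Set β} :
    KIndep G k I ↔ I ⊆ E(G) ∧ ∀ X ⊆ I, excess (edgeInduce G X) < k := by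
  refine and_congr_right fun hI => ⟨fun h X hX => ?_, fun h C hC hCI => ?_⟩
  · by_contra hcon
    obtain ⟨C, hC, hCX⟩ := exists_mem_kCircuits hE hk (hX.trans hI) (not_lt.1 hcon)
    exact h C hC (hCX.trans hX)
  · have := h C hCI
    rw [hC.2.1] at this
    exact lt_irrefl _ this

theorem kIndep_empty (G : Graph α β) {k : ℕ} (hk : 1 ≤ k) : KIndep G k ∅ := by
  refine ⟨Set.empty_subset _, fun C hC hC0 => ?_⟩
  obtain rfl := Set.subset_empty_iff.1 hC0
  have h := hC.2.1
  have hV : V(edgeInduce G ∅) = ∅ := by ext x; simp [mem_vertexSet_edgeInduce]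
  rw [excess_edgeInduce (Set.empty_subset _), hV] at h
  simp at h
  omega

theorem kIndep_aug {G : Graph α β} (hE : E(G).Finite) {k : ℕ} (hk : 1 ≤ k) {I J : Set β}
    (hI : KIndep G k I) (hJ : KIndep G k J) (hlt : I.ncard < J.ncard) :
    ∃ e ∈ J, e ∉ I ∧ KIndep G k (insert e I) := by
  rw [kIndep_iff hE hk] at hI hJ
  obtain ⟨hIE, hI⟩ := hI
  obtain ⟨hJE, hJ⟩ := hJ
  have fI := hE.subset hIE
  have fJ := hE.subset hJE
  by_contra! hcon
  have hT : ∀ e ∈ J, e ∉ I → ∃ T ⊆ I, (k : ℤ) - 1 ≤ excess (edgeInduce G T) ∧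
      ∀ x, G.Inc e x → x ∈ V(edgeInduce G T) := by
    intro e heJ heI
    have h := hcon e heJ heI
    rw [kIndep_iff hE hk] at h
    push Not at h
    obtain ⟨X, hXI, hX⟩ := h (Set.insert_subset (hJE heJ) hIE)
    have heX : e ∈ X := by
      by_contra heX
      have := hI X ((Set.subset_insert_iff_of_notMem heX).1 hXI)
      omega
    have hTI : X \ {e} ⊆ I := fun f hf => (hXI hf.1).resolve_left hf.2
    have hXE : X ⊆ E(G) := hXI.trans (Set.insert_subset (hJE heJ) hIE)
    have fX := hE.subset hXE
    have hTX : X \ {e} ⊆ X := Set.sdiff_subset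
    have h1 := hI _ hTI
    rw [excess_edgeInduce hXE] at hX
    have h2 := Set.ncard_sdiff_singleton_add_one heX fX
    have hmono := vertexSet_edgeInduce_mono G hTX
    have h3 := Set.ncard_le_ncard hmono (vertexSet_edgeInduce_finite G fX)
    rw [excess_edgeInduce (hTX.trans hXE)] at h1
    refine ⟨X \ {e}, hTI, ?_, fun x hx => ?_⟩
    · rw [excess_edgeInduce (hTX.trans hXE)]
      omega
    · have : V(edgeInduce G (X \ {e})) = V(edgeInduce G X) :=
        Set.eq_of_subset_of_ncard_le hmono (by omega) (vertexSet_edgeInduce_finite G fX)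
      rw [this]
      exact ⟨e, heX, hx⟩
  have hfin : {T : Set β | T ⊆ I ∧ (k : ℤ) - 1 ≤ excess (edgeInduce G T)}.Finite :=
    fI.finite_subsets.subset fun Y hY => hY.1
  have hJI : ∃ e ∈ J, e ∉ I := by
    by_contra! h
    exact absurd (Set.ncard_le_ncard h fI) (by omega)
  obtain ⟨e₁, he₁J, he₁I⟩ := hJI
  obtain ⟨T₁, hT₁I, hT₁, -⟩ := hT e₁ he₁J he₁I
  obtain ⟨T, hTmax⟩ := hfin.exists_maximal ⟨T₁, hT₁I, hT₁⟩
  have hTI := hTmax.prop.1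
  have hTd := hTmax.prop.2
  have hTE := hTI.trans hIE
  have fT := hE.subset hTE
  have hall : ∀ e ∈ J, e ∉ I → ∀ x, G.Inc e x → x ∈ V(edgeInduce G T) := by
    intro e heJ heI x hx
    obtain ⟨S, hSI, hSd, hSx⟩ := hT e heJ heI
    have hsup := excess_supermodular hE hTE (hSI.trans hIE)
    have hint := hI (T ∩ S) (Set.inter_subset_left.trans hTI)
    have hle := hTmax.2 (y := T ∪ S) ⟨Set.union_subset hTI hSI, by omega⟩ Set.subset_union_left
    exact vertexSet_edgeInduce_mono G (Set.subset_union_right.trans hle) (hSx x hx)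
  have hJ'J : J \ (I \ T) ⊆ J := Set.sdiff_subset
  have h1 := hJ _ hJ'J
  rw [excess_edgeInduce (hJ'J.trans hJE)] at h1
  have hsub : V(edgeInduce G (J \ (I \ T))) ⊆ V(edgeInduce G T) := by
    rintro x ⟨e, he, hx⟩
    by_cases heI : e ∈ I
    · have heT : e ∈ T := by
        by_contra heT
        exact he.2 ⟨heI, heT⟩
      exact ⟨e, heT, hx⟩
    · exact hall e he.1 heI x hx
  have h2 := Set.ncard_le_ncard hsub (vertexSet_edgeInduce_finite G fT)
  rw [excess_edgeInduce hTE] at hTd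
  have h3 := Set.ncard_sdiff_add_ncard_of_subset hTI fI
  have h4 : J.ncard ≤ (J \ (I \ T)).ncard + (I \ T).ncard := by
    have h := Set.ncard_le_ncard_sdiff_add_ncard J (I \ T) (fI.subset Set.sdiff_subset)
    exact h
  omega

/-- The `k`-circular matroid `M_k(G)` of a graph `G` with finitely many edges, where `k ≥ 1`: its
ground set is `E(G)` and its circuits are the members of `C_k(G)`
(see `kCircularMatroid_isCircuit_iff`). -/
noncomputable def kCircularMatroid (G : Graph α β) (hE : E(G).Finite) (k : ℕ) (hk : 1 ≤ k) :
    Matroid β :=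
  (IndepMatroid.ofFinite hE (KIndep G k) (kIndep_empty G hk)
    (fun _ _ hJ hIJ => ⟨hIJ.trans hJ.1, fun C hC hCI => hJ.2 C hC (hCI.trans hIJ)⟩)
    (fun _ _ hI hJ hlt => kIndep_aug hE hk hI hJ hlt) (fun _ hI => hI.1)).matroid

theorem kCircularMatroid_ground (G : Graph α β) (hE : E(G).Finite) (k : ℕ) (hk : 1 ≤ k) :
    (kCircularMatroid G hE k hk).E = E(G) := rfl

theorem kCircularMatroid_indep_iff (G : Graph α β) (hE : E(G).Finite) (k : ℕ) (hk : 1 ≤ k)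
    {I : Set β} : (kCircularMatroid G hE k hk).Indep I ↔ KIndep G k I := Iff.rfl

theorem kCircularMatroid_isCircuit_iff (G : Graph α β) (hE : E(G).Finite) (k : ℕ) (hk : 1 ≤ k)
    {C : Set β} : (kCircularMatroid G hE k hk).IsCircuit C ↔ C ∈ kCircuits G k := by
  have hdep : ∀ C ∈ kCircuits G k, (kCircularMatroid G hE k hk).Dep C := fun C hC =>
    ⟨fun h => h.2 C hC subset_rfl, hC.1⟩
  constructor
  · intro h
    have h1 : ¬ KIndep G k C := h.dep.not_indep
    have hCE : C ⊆ E(G) := h.subset_ground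
    rw [KIndep] at h1
    push Not at h1
    obtain ⟨D, hD, hDC⟩ := h1 hCE
    rwa [← h.eq_of_dep_subset (hdep D hD) hDC]
  · intro hC
    refine ⟨hdep C hC, fun D hD hDC => ?_⟩
    by_contra hne
    have h1 : ¬ KIndep G k D := hD.not_indep
    rw [KIndep] at h1
    push Not at h1
    obtain ⟨F, hF, hFD⟩ := h1 (hDC.trans hC.1)
    have h2 := excess_lt_of_ssubset hE hC.1 hC.2.2
      ⟨hFD.trans hDC, fun h => hne (h.trans hFD)⟩
    rw [hC.2.1, hF.2.1] at h2
    exact lt_irrefl _ h2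

/-- The corank of `M_k(G)`, i.e. the rank of its dual matroid. -/
noncomputable def corank (G : Graph α β) (hE : E(G).Finite) (k : ℕ) (hk : 1 ≤ k) : ℕ∞ :=
  (kCircularMatroid G hE k hk)✶.eRank

/-- The vertex `x` is `k`-small: its star (the set of edges incident to `x`) has fewer than
`corank + 1` elements. -/
def IsKSmall (G : Graph α β) (hE : E(G).Finite) (k : ℕ) (hk : 1 ≤ k) (x : α) : Prop :=
  (G.incidenceSet x).encard < corank G hE k hk + 1

/-- The vertex `x` is `k`-tight: its star has exactly `corank + 1` elements. -/
def IsKTight (G : Graph α β) (hE : E(G).Finite) (k : ℕ) (hk : 1 ≤ k) (x : α) : Prop :=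
  (G.incidenceSet x).encard = corank G hE k hk + 1

/-- Two graphs with the same edges are strongly isomorphic if some bijection between their vertex
sets respects the ends of every edge. -/
def StronglyIsomorphic {α' : Type u} (G : Graph α β) (G' : Graph α' β) : Prop :=
  E(G) = E(G') ∧ ∃ ν : V(G) ≃ V(G'), ∀ (e : β) (x y : V(G)),
    G.IsLink e x y ↔ G'.IsLink e (ν x) (ν y)

/-- `G` is uniquely defined by `M_k(G)`: every finite graph without isolated vertices (loops and
parallel edges being allowed) that has the same `k`-circular matroid is strongly isomorphic to
`G`. (Isolated vertices are invisible in `M_k`.) -/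
def UniquelyDefined (G : Graph α β) (hE : E(G).Finite) (k : ℕ) (hk : 1 ≤ k) : Prop :=
  ∀ (α' : Type u) (G' : Graph α' β), V(G').Finite → ∀ hE' : E(G').Finite, NoIsolatedVertex G' →
    kCircularMatroid G' hE' k hk = kCircularMatroid G hE k hk → StronglyIsomorphic G G'

/-- `3`-connected: at least four vertices, no loops, and deleting fewer than three
vertices leaves a connected graph. Parallel edges are not excluded. -/
def IsThreeConnected (G : Graph α β) : Prop :=
  G.Loopless ∧ 4 ≤ V(G).encard ∧
    ∀ X ⊆ V(G), X.encard < 3 → IsConnected (G.deleteVerts X)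

end KCircular

namespace KCircular

/-!
A connected graph `H` with `k ≤ Δ(H) + 1` has rank `|V(H)| + k - 1` in the `k`-circular matroid,
so the matroid knows how many vertices a cyclic set of edges covers. If `x` is `k`-small, then the
complement of its star is such a cyclic set, missing exactly one vertex, and the star is recovered
from the matroid. If one vertex remains, its star is then found by elimination, and the stars
determine the graph. Conversely, if `Δ(G - x) < k`, then all edges of `G - x` are independent, and a
circuit must meet the star of `x`. So moving an end of an edge from `x` to a neighbour (when
`Δ(G - x) + 1 < k`), or exchanging the ends `x₁` and `x₂` of two edges at two such vertices, does
not change the matroid, although it changes the graph.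
-/

variable {α β : Type*} {G H : Graph α β} {k : ℕ} {hk : 1 ≤ k} {hE : E(G).Finite}

section Subgraph

theorem edgeInduce_of_le (hHG : H ≤ G) {X : Set β} (hX : X ⊆ E(H)) :
    edgeInduce H X = edgeInduce G X := by
  have hinc : ∀ e ∈ X, ∀ x, H.Inc e x ↔ G.Inc e x := fun e he x => hHG.inc_congr (hX he)
  refine Graph.ext_inc (Set.ext fun x => ?_) fun e x => ?_
  · exact exists_congr fun e => and_congr_right fun he => hinc e he x
  · rw [edgeInduce_inc, edgeInduce_inc]
    exact and_congr_right fun he => hinc e he x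

theorem mem_kCircuits_iff_of_le (hHG : H ≤ G) {C : Set β} (hC : C ⊆ E(H)) :
    C ∈ kCircuits H k ↔ C ∈ kCircuits G k := by
  rw [kCircuits, kCircuits, Set.mem_ofPred_eq, Set.mem_ofPred_eq, edgeInduce_of_le hHG hC,
    and_iff_right hC, and_iff_right (hC.trans hHG.edgeSet_mono)]

theorem kIndep_iff_of_le (hHG : H ≤ G) {I : Set β} (hI : I ⊆ E(H)) :
    KIndep H k I ↔ KIndep G k I := by
  refine and_congr (iff_of_true hI (hI.trans hHG.edgeSet_mono)) (forall_congr' fun C => ?_)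
  exact ⟨fun h hC hCI => h ((mem_kCircuits_iff_of_le hHG (hCI.trans hI)).2 hC) hCI,
    fun h hC hCI => h ((mem_kCircuits_iff_of_le hHG hC.1).1 hC) hCI⟩

theorem kCircularMatroid_restrict (hHG : H ≤ G) :
    (kCircularMatroid G hE k hk).restrict E(H) =
      kCircularMatroid H (hE.subset hHG.edgeSet_mono) k hk :=
  Matroid.ext_indep rfl fun I hI => by
    have hIH : I ⊆ E(H) := hI
    rw [Matroid.restrict_indep_iff, kCircularMatroid_indep_iff, kCircularMatroid_indep_iff,
      kIndep_iff_of_le hHG hIH, and_iff_left hIH]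

theorem eRk_kCircularMatroid_edgeSet (hHG : H ≤ G) :
    (kCircularMatroid G hE k hk).eRk E(H) =
      (kCircularMatroid H (hE.subset hHG.edgeSet_mono) k hk).eRank := by
  rw [← kCircularMatroid_restrict hHG, Matroid.eRank_restrict]

theorem NoIsolatedVertex.vertexSet_edgeInduce_edgeSet (hG : NoIsolatedVertex G) :
    V(edgeInduce G E(G)) = V(G) :=
  Set.ext fun x => ⟨fun ⟨_, _, hex⟩ => hex.vertex_mem,
    fun hx => (hG x hx).imp fun _ he => ⟨he.edge_mem, he⟩⟩

theorem vertexSet_edgeInduce_subset {X : Set β} : V(edgeInduce G X) ⊆ V(G) :=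
  fun _ ⟨_, _, hex⟩ => hex.vertex_mem

theorem edgeSet_deleteVerts_singleton (x : α) :
    E(G.deleteVerts {x}) = E(G) \ G.incidenceSet x := by
  ext e
  simp only [edgeSet_deleteVerts, Set.mem_ofPred_eq, Set.mem_singleton_iff, Set.mem_sdiff,
    mem_incidenceSet]
  constructor
  · rintro ⟨a, b, hab, ha, hb⟩
    refine ⟨hab.edge_mem, fun hx => ?_⟩
    rcases hx.eq_or_eq_of_isLink hab with rfl | rfl
    exacts [ha rfl, hb rfl]
  · rintro ⟨he, hx⟩
    obtain ⟨a, b, hab⟩ := G.exists_isLink_of_mem_edgeSet he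
    exact ⟨a, b, hab, fun h => hx (h ▸ hab.inc_left), fun h => hx (h ▸ hab.inc_right)⟩

theorem notMem_edgeSet_deleteVerts_singleton {e : β} {x : α} (hex : G.Inc e x) :
    e ∉ E(G.deleteVerts {x}) :=
  fun he => (edgeSet_deleteVerts_singleton x ▸ he).2 hex

theorem excess_deleteVerts_singleton (hV : V(G).Finite) (hE : E(G).Finite) {x : α}
    (hx : x ∈ V(G)) :
    excess (G.deleteVerts {x}) + (G.incidenceSet x).ncard = excess G + 1 := by
  have hEx := Set.ncard_sdiff_add_ncard_of_subset (G.incidenceSet_subset_edgeSet x) hE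
  have hVx := Set.ncard_sdiff_singleton_add_one hx hV
  rw [excess, excess, edgeSet_deleteVerts_singleton, vertexSet_deleteVerts]
  omega

end Subgraph

section Saturated

/-- An edge set is saturated if its excess is `k - 1`, the largest value allowed for an
independent set of the `k`-circular matroid. -/
def IsSaturated (G : Graph α β) (k : ℕ) (T : Set β) : Prop := excess (edgeInduce G T) + 1 = k

theorem IsSaturated.union (hE : E(G).Finite) (hk : 1 ≤ k) {I S T : Set β} (hI : KIndep G k I)
    (hSI : S ⊆ I) (hTI : T ⊆ I) (hS : IsSaturated G k S) (hT : IsSaturated G k T) :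
    IsSaturated G k (S ∪ T) := by
  obtain ⟨hIE, hI⟩ := (kIndep_iff hE hk).1 hI
  have hsup := excess_supermodular hE (hSI.trans hIE) (hTI.trans hIE)
  have hunion := hI (S ∪ T) (Set.union_subset hSI hTI)
  have hinter := hI (S ∩ T) (Set.inter_subset_left.trans hSI)
  rw [IsSaturated] at *
  omega

theorem KIndep.exists_isGreatest_isSaturated (hE : E(G).Finite) (hk : 1 ≤ k) {I S : Set β}
    (hI : KIndep G k I) (hSI : S ⊆ I) (hS : IsSaturated G k S) :
    ∃ T, IsGreatest {T | T ⊆ I ∧ IsSaturated G k T} T := by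
  have hfin : {T | T ⊆ I ∧ IsSaturated G k T}.Finite :=
    (hE.subset hI.1).finite_subsets.subset fun T hT => hT.1
  obtain ⟨T, ⟨hTI, hT⟩, hmax⟩ := hfin.exists_maximal ⟨S, hSI, hS⟩
  refine ⟨T, ⟨hTI, hT⟩, fun R ⟨hRI, hR⟩ => ?_⟩
  have hTR : T ∪ R ⊆ T :=
    hmax ⟨Set.union_subset hTI hRI, hT.union hE hk hI hTI hRI hR⟩ Set.subset_union_left
  exact Set.subset_union_right.trans hTR

theorem isSaturated_sdiff_singleton (hE : E(G).Finite) {C : Set β} (hC : C ∈ kCircuits G k)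
    {f : β} (hf : f ∈ C) :
    IsSaturated G k (C \ {f}) ∧ V(edgeInduce G (C \ {f})) = V(edgeInduce G C) := by
  obtain ⟨hCE, hCk, hCacti⟩ := hC
  have hCfin := hE.subset hCE
  have hlt := excess_lt_of_ssubset hE hCE hCacti (Set.sdiff_singleton_ssubset.2 hf)
  have hVfin := vertexSet_edgeInduce_finite G hCfin
  have hVsub := vertexSet_edgeInduce_mono G (Set.sdiff_subset (s := C) (t := {f}))
  have hVle := Set.ncard_le_ncard hVsub hVfin
  have hcard := Set.ncard_sdiff_singleton_add_one hf hCfin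
  rw [IsSaturated, ← hCk]
  rw [excess_edgeInduce hCE, excess_edgeInduce (Set.sdiff_subset.trans hCE)] at *
  exact ⟨by omega, Set.eq_of_subset_of_ncard_le hVsub (by omega) hVfin⟩

theorem KIndep.exists_isSaturated_of_not_kIndep_insert (hE : E(G).Finite) {I : Set β} {f : β}
    (hI : KIndep G k I) (hf : f ∈ E(G)) (hdep : ¬ KIndep G k (insert f I)) :
    ∃ T ⊆ I, IsSaturated G k T ∧ ∀ x, G.Inc f x → x ∈ V(edgeInduce G T) := by
  have ⟨C, hC, hCI⟩ : ∃ C ∈ kCircuits G k, C ⊆ insert f I := by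
    by_contra! h
    exact hdep ⟨Set.insert_subset hf hI.1, h⟩
  have hfC : f ∈ C := by
    by_contra hfC
    exact hI.2 C hC ((Set.subset_insert_iff_of_notMem hfC).1 hCI)
  obtain ⟨hsat, hV⟩ := isSaturated_sdiff_singleton hE hC hfC
  exact ⟨C \ {f}, Set.sdiff_singleton_subset_iff.2 hCI, hsat, fun x hx => hV ▸ ⟨f, hfC, hx⟩⟩

theorem exists_isGreatest_isSaturated_of_isBasis {B X : Set β}
    (hB : (kCircularMatroid G hE k hk).IsBasis B X) (hne : (X \ B).Nonempty) :
    ∃ T, IsGreatest {T | T ⊆ B ∧ IsSaturated G k T} T ∧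
      ∀ f ∈ X \ B, ∀ x, G.Inc f x → x ∈ V(edgeInduce G T) := by
  have hBI : KIndep G k B := hB.indep
  have hsat : ∀ f ∈ X \ B, ∃ T ⊆ B, IsSaturated G k T ∧
      ∀ x, G.Inc f x → x ∈ V(edgeInduce G T) := fun f hf =>
    hBI.exists_isSaturated_of_not_kIndep_insert hE (hB.subset_ground hf.1)
      (hB.insert_dep hf).not_indep
  obtain ⟨f, hf⟩ := hne
  obtain ⟨S, hSB, hS, -⟩ := hsat f hf
  obtain ⟨T, hT⟩ := hBI.exists_isGreatest_isSaturated hE hk hSB hS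
  refine ⟨T, hT, fun f hf x hx => ?_⟩
  obtain ⟨R, hRB, hR, hfR⟩ := hsat f hf
  exact vertexSet_edgeInduce_mono G (hT.2 ⟨hRB, hR⟩) (hfR x hx)

end Saturated

section Rank

variable {α' : Type*} {G' : Graph α' β} {hE' : E(G').Finite}

theorem IsSaturated.encard_add_one (hE : E(G).Finite) {T : Set β} (hTE : T ⊆ E(G))
    (hT : IsSaturated G k T) : T.encard + 1 = V(edgeInduce G T).encard + k := by
  have hTfin := hE.subset hTE
  rw [IsSaturated, excess_edgeInduce hTE] at hT
  rw [← hTfin.cast_ncard_eq, ← (vertexSet_edgeInduce_finite G hTfin).cast_ncard_eq]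
  norm_cast
  omega

theorem KIndep.encard_add_one_le (hE : E(G).Finite) (hk : 1 ≤ k) {I : Set β}
    (hI : KIndep G k I) : I.encard + 1 ≤ V(edgeInduce G I).encard + k := by
  have hIfin := hE.subset hI.1
  have hexc := ((kIndep_iff hE hk).1 hI).2 I subset_rfl
  rw [excess_edgeInduce hI.1] at hexc
  rw [← hIfin.cast_ncard_eq, ← (vertexSet_edgeInduce_finite G hIfin).cast_ncard_eq]
  norm_cast
  omega

theorem eRk_kCircularMatroid_add_one_le (X : Set β) :
    (kCircularMatroid G hE k hk).eRk X + 1 ≤ V(edgeInduce G X).encard + k := by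
  obtain ⟨B, hB⟩ := (kCircularMatroid G hE k hk).exists_isBasis' X
  have hBI : KIndep G k B := hB.indep
  rw [← hB.encard_eq_eRk]
  have hV := Set.encard_le_encard (vertexSet_edgeInduce_mono G hB.subset)
  exact (hBI.encard_add_one_le hE hk).trans (by gcongr)

theorem excess_add_excess_le_of_disjoint (hE : E(G).Finite) {C D T : Set β} (hC : C ⊆ E(G))
    (hT : T ⊆ E(G)) (hDC : D ⊆ C) (hDT : V(edgeInduce G D) ⊆ V(edgeInduce G T))
    (hdisj : Disjoint T (C \ D)) :
    excess (edgeInduce G T) + excess (edgeInduce G C) ≤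
      excess (edgeInduce G (T ∪ C \ D)) + excess (edgeInduce G D) := by
  have hCfin := hE.subset hC
  have hVC := vertexSet_edgeInduce_finite G hCfin
  have hVD := vertexSet_edgeInduce_mono G hDC
  have hV : V(edgeInduce G (T ∪ C \ D)) ⊆
      V(edgeInduce G T) ∪ (V(edgeInduce G C) \ V(edgeInduce G D)) := by
    rw [vertexSet_edgeInduce_union]
    refine Set.union_subset Set.subset_union_left fun x hx => ?_
    by_cases hxD : x ∈ V(edgeInduce G D)
    exacts [Or.inl (hDT hxD), Or.inr ⟨vertexSet_edgeInduce_mono G Set.sdiff_subset hx, hxD⟩]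
  have hVle := (Set.ncard_le_ncard hV ((vertexSet_edgeInduce_finite G (hE.subset hT)).union
    hVC.sdiff)).trans (Set.ncard_union_le _ _)
  have hVcard := Set.ncard_sdiff_add_ncard_of_subset hVD hVC
  have hcard := Set.ncard_sdiff_add_ncard_of_subset hDC hCfin
  have hunion := Set.ncard_union_eq hdisj (hE.subset hT) hCfin.sdiff
  rw [excess_edgeInduce hC, excess_edgeInduce hT, excess_edgeInduce (hDC.trans hC),
    excess_edgeInduce (Set.union_subset hT (Set.sdiff_subset.trans hC))]
  omega

/-- A set of a matroid is cyclic if it is a union of circuits; equivalently, each of its elements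
lies in the closure of the others, which is the form used here. -/
def IsCyclicSet (M : Matroid β) (X : Set β) : Prop := ∀ e ∈ X, e ∈ M.closure (X \ {e})

theorem IsCyclicSet.subset_ground {M : Matroid β} {X : Set β} (hX : IsCyclicSet M X) :
    X ⊆ M.E :=
  fun e he => M.closure_subset_ground _ (hX e he)

theorem IsCyclicSet.not_indep {M : Matroid β} {X : Set β} (hX : IsCyclicSet M X)
    (hne : X.Nonempty) : ¬ M.Indep X :=
  fun hI => hI.notMem_closure_sdiff_of_mem hne.some_mem (hX _ hne.some_mem)

theorem mem_of_mem_closure_sdiff_singleton {B T X : Set β} {e : β}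
    (hB : (kCircularMatroid G hE k hk).IsBasis B X) (hTB : T ⊆ B) (hT : IsSaturated G k T)
    (hXT : ∀ f ∈ X \ B, ∀ x, G.Inc f x → x ∈ V(edgeInduce G T)) (heB : e ∈ B)
    (he : e ∈ (kCircularMatroid G hE k hk).closure (X \ {e})) : e ∈ T := by
  by_contra heT
  have hBE : B ⊆ E(G) := hB.indep.subset_ground
  obtain ⟨C, hCX, hC, heC⟩ := (Matroid.mem_closure_iff_exists_isCircuit (fun h => h.2 rfl)).1 he
  rw [kCircularMatroid_isCircuit_iff] at hC
  rw [Set.insert_sdiff_singleton, Set.insert_eq_of_mem (hB.subset heB)] at hCX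
  -- Trading the part `D` of `C` outside `B \ T` for `T` keeps the excess at least `k`, as all ends
  -- of the edges of `D` are vertices of `T`; but the outcome lies in the independent set `B`.
  let D := C \ (B \ T)
  have hDC : D ⊂ C := ⟨Set.sdiff_subset, fun h => (h heC).2 ⟨heB, heT⟩⟩
  have hDT : V(edgeInduce G D) ⊆ V(edgeInduce G T) := by
    rintro x ⟨f, ⟨hfC, hfBT⟩, hfx⟩
    by_cases hfT : f ∈ T
    exacts [⟨f, hfT, hfx⟩, hXT f ⟨hCX hfC, fun hfB => hfBT ⟨hfB, hfT⟩⟩ x hfx]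
  have hCD : C \ D ⊆ B \ T := by
    rw [Set.sdiff_sdiff_right_self]
    exact Set.inter_subset_right
  have htrade := excess_add_excess_le_of_disjoint hE hC.1 (hTB.trans hBE) hDC.1 hDT
    (Set.disjoint_sdiff_right.mono_right hCD)
  have hlt := excess_lt_of_ssubset hE hC.1 hC.2.2 hDC
  have hind := ((kIndep_iff hE hk).1 hB.indep).2 (T ∪ C \ D)
    (Set.union_subset hTB (hCD.trans Set.sdiff_subset))
  rw [IsSaturated] at hT
  omega

theorem IsCyclicSet.isSaturated_of_isBasis {B X : Set β}
    (hX : IsCyclicSet (kCircularMatroid G hE k hk) X) (hne : X.Nonempty)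
    (hB : (kCircularMatroid G hE k hk).IsBasis B X) :
    IsSaturated G k B ∧ V(edgeInduce G B) = V(edgeInduce G X) := by
  have hXB : (X \ B).Nonempty := by
    refine Set.sdiff_nonempty.2 fun hXB => hX.not_indep hne ?_
    exact hXB.antisymm hB.subset ▸ hB.indep
  obtain ⟨T, ⟨⟨hTB, hT⟩, -⟩, hXT⟩ := exists_isGreatest_isSaturated_of_isBasis hB hXB
  obtain rfl : T = B := hTB.antisymm fun e heB =>
    mem_of_mem_closure_sdiff_singleton hB hTB hT hXT heB (hX e (hB.subset heB))
  refine ⟨hT, (vertexSet_edgeInduce_mono G hB.subset).antisymm ?_⟩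
  rintro x ⟨f, hfX, hfx⟩
  by_cases hfT : f ∈ T
  exacts [⟨f, hfT, hfx⟩, hXT f ⟨hfX, hfT⟩ x hfx]

theorem IsCyclicSet.eRk_add_one {X : Set β} (hX : IsCyclicSet (kCircularMatroid G hE k hk) X)
    (hne : X.Nonempty) :
    (kCircularMatroid G hE k hk).eRk X + 1 = V(edgeInduce G X).encard + k := by
  obtain ⟨B, hB⟩ := (kCircularMatroid G hE k hk).exists_isBasis X hX.subset_ground
  obtain ⟨hsat, hV⟩ := hX.isSaturated_of_isBasis hne hB
  rw [← hB.encard_eq_eRk, hsat.encard_add_one hE hB.indep.subset_ground, hV]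

theorem IsCyclicSet.encard_vertexSet_edgeInduce_eq
    (hM : kCircularMatroid G' hE' k hk = kCircularMatroid G hE k hk) {X : Set β}
    (hX : IsCyclicSet (kCircularMatroid G hE k hk) X) (hne : X.Nonempty) :
    V(edgeInduce G' X).encard = V(edgeInduce G X).encard := by
  have h := hX.eRk_add_one hne
  rw [← hM] at hX h
  rw [hX.eRk_add_one hne] at h
  exact ENat.add_left_injective_of_ne_top (ENat.natCast_ne_top k) h

end Rank

section Connected

theorem isConnected_iff_exists_isLink_of_ssubset : IsConnected G ↔ V(G).Nonempty ∧
    ∀ W ⊂ V(G), W.Nonempty → ∃ e, ∃ x ∈ W, ∃ y ∉ W, G.IsLink e x y := by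
  refine ⟨fun hG => ⟨?_, ?_⟩, fun ⟨⟨x, hx⟩, hcut⟩ => ?_⟩
  · obtain ⟨x, hx⟩ := SimpleGraph.Connected.nonempty hG
    exact ⟨x, hx⟩
  · rintro W ⟨hWV, hVW⟩ ⟨x, hxW⟩
    obtain ⟨y, hy, hyW⟩ := Set.not_subset.1 hVW
    obtain ⟨p⟩ := SimpleGraph.Connected.preconnected hG ⟨x, hWV hxW⟩ ⟨y, hy⟩
    obtain ⟨d, -, hd₁, hd₂⟩ := p.exists_boundary_dart {z | (z : α) ∈ W} hxW hyW
    obtain ⟨-, e, he⟩ := toSimpleGraph_adj G _ _ ▸ d.adj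
    exact ⟨e, d.fst, hd₁, d.snd, hd₂, he⟩
  · let R : Set V(G) := {y | G.toSimpleGraph.Reachable ⟨x, hx⟩ y}
    have hxR : x ∈ ((↑) '' R : Set α) := ⟨⟨x, hx⟩, SimpleGraph.Reachable.refl _, rfl⟩
    refine SimpleGraph.connected_iff_exists_forall_reachable _ |>.2 ⟨⟨x, hx⟩, ?_⟩
    by_contra! ⟨y, hy⟩
    have hRV : ((↑) '' R : Set α) ⊂ V(G) := by
      refine ⟨Subtype.coe_image_subset _ _, fun h => hy ?_⟩
      obtain ⟨z, hz, hzy⟩ := h y.2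
      exact Subtype.ext hzy ▸ hz
    obtain ⟨e, _, ⟨a, ha, rfl⟩, b, hb, hab⟩ := hcut _ hRV ⟨x, hxR⟩
    refine hb ⟨⟨b, hab.right_mem⟩, ha.trans (SimpleGraph.Adj.reachable ?_), rfl⟩
    rw [toSimpleGraph_adj]
    exact ⟨fun h => hb ⟨a, ha, congrArg Subtype.val h⟩, e, hab⟩

theorem IsConnected.of_isSpanningSubgraph (hHG : H ≤s G) (hH : IsConnected H) :
    IsConnected G := by
  rw [isConnected_iff_exists_isLink_of_ssubset] at hH ⊢
  rw [← hHG.vertexSet_eq]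
  refine ⟨hH.1, fun W hW hne => ?_⟩
  obtain ⟨e, x, hx, y, hy, hxy⟩ := hH.2 W hW hne
  exact ⟨e, x, hx, y, hy, hxy.mono hHG.le⟩

theorem IsConnected.of_deleteVerts_singleton {x y : α} {e : β}
    (hx : IsConnected (G.deleteVerts {x})) (hxy : G.IsLink e x y) (hne : y ≠ x) :
    IsConnected G := by
  rw [isConnected_iff_exists_isLink_of_ssubset] at hx ⊢
  rw [vertexSet_deleteVerts] at hx
  refine ⟨⟨x, hxy.left_mem⟩, fun W hW hWne => ?_⟩
  rcases (W \ {x}).eq_empty_or_nonempty with hW₀ | hW₀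
  · obtain rfl := hWne.subset_singleton_iff.1 (Set.sdiff_eq_empty.1 hW₀)
    exact ⟨e, x, rfl, y, hne, hxy⟩
  · have hsub : W \ {x} ⊆ V(G) \ {x} := Set.sdiff_subset_sdiff_left hW.1
    rcases hsub.eq_or_ssubset with hWx | hWx
    · have hxW : x ∉ W := fun hxW => hW.not_subset fun z hz => by
        by_cases hzx : z = x
        exacts [hzx ▸ hxW, (hWx.ge ⟨hz, hzx⟩).1]
      exact ⟨e, y, (hWx.ge ⟨hxy.right_mem, hne⟩).1, x, hxW, hxy.symm⟩
    · obtain ⟨f, a, ha, b, hb, hab⟩ := hx.2 _ hWx hW₀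
      rw [deleteVerts_isLink] at hab
      exact ⟨f, a, ha.1, b, fun hbW => hb ⟨hbW, hab.2.2⟩, hab.1⟩

theorem IsConnected.insert_vertexSet_edgeInduce_edgeSet (hG : IsConnected G) {x : α}
    (hx : x ∈ V(G)) : insert x V(edgeInduce G E(G)) = V(G) := by
  have hsub : insert x V(edgeInduce G E(G)) ⊆ V(G) :=
    Set.insert_subset hx vertexSet_edgeInduce_subset
  by_contra hne
  obtain ⟨e, a, -, b, hb, hab⟩ := (isConnected_iff_exists_isLink_of_ssubset.1 hG).2 _
    (hsub.ssubset_of_ne hne) (Set.insert_nonempty _ _)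
  exact hb (Or.inr ⟨e, hab.edge_mem, hab.inc_right⟩)

theorem IsConnected.finite_vertexSet (hG : IsConnected G) (hE : E(G).Finite) : V(G).Finite := by
  obtain ⟨x, hx⟩ := (isConnected_iff_exists_isLink_of_ssubset.1 hG).1
  rw [← hG.insert_vertexSet_edgeInduce_edgeSet hx]
  exact (vertexSet_edgeInduce_finite G hE).insert x

theorem IsConnected.noIsolatedVertex (hG : IsConnected G) (hne : E(G).Nonempty) :
    NoIsolatedVertex G := by
  intro x hx
  obtain ⟨e, he⟩ := hne
  obtain ⟨y, z, hyz⟩ := G.exists_isLink_of_mem_edgeSet he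
  rw [← hG.insert_vertexSet_edgeInduce_edgeSet hyz.left_mem] at hx
  obtain rfl | ⟨f, -, hf⟩ := hx
  exacts [⟨e, hyz.inc_left⟩, ⟨f, hf⟩]

theorem IsSaturated.insert_of_isLink (hE : E(G).Finite) (hk : 1 ≤ k) {I T : Set β} {e : β}
    {x y : α} (hT : IsSaturated G k T) (hI : KIndep G k I) (hTI : T ⊆ I) (heI : e ∈ I)
    (hxy : G.IsLink e x y) (hx : x ∈ V(edgeInduce G T)) : IsSaturated G k (insert e T) := by
  by_cases heT : e ∈ T
  · rwa [Set.insert_eq_of_mem heT]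
  have hTfin := hE.subset (hTI.trans hI.1)
  have heTI : insert e T ⊆ I := Set.insert_subset heI hTI
  have hexc := ((kIndep_iff hE hk).1 hI).2 _ heTI
  have hcard := Set.ncard_insert_of_notMem heT hTfin
  have hV : V(edgeInduce G (insert e T)) ⊆ insert y V(edgeInduce G T) := by
    rintro z ⟨f, rfl | hf, hz⟩
    · obtain rfl | rfl := hz.eq_or_eq_of_isLink hxy
      exacts [Or.inr hx, Or.inl rfl]
    · exact Or.inr ⟨f, hf, hz⟩
  have hVcard := (Set.ncard_le_ncard hV ((vertexSet_edgeInduce_finite G hTfin).insert y)).trans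
    (Set.ncard_insert_le _ _)
  rw [IsSaturated, excess_edgeInduce (hTI.trans hI.1)] at hT
  rw [excess_edgeInduce (heTI.trans hI.1)] at hexc
  rw [IsSaturated, excess_edgeInduce (heTI.trans hI.1)]
  omega

theorem IsConnected.exists_isSaturated_spanning (hG : IsConnected G) {B : Set β}
    (hB : (kCircularMatroid G hE k hk).IsBasis B E(G)) (hdep : ¬ KIndep G k E(G)) :
    ∃ T ⊆ B, IsSaturated G k T ∧ V(edgeInduce G T) = V(G) := by
  have ⟨f, hf⟩ : (E(G) \ B).Nonempty :=
    Set.sdiff_nonempty.2 fun hEB => hdep (hEB.antisymm hB.subset ▸ hB.indep)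
  obtain ⟨T, ⟨⟨hTB, hT⟩, hmax⟩, hends⟩ := exists_isGreatest_isSaturated_of_isBasis hB ⟨f, hf⟩
  refine ⟨T, hTB, hT, ?_⟩
  by_contra hne
  obtain ⟨z, w, hzw⟩ := G.exists_isLink_of_mem_edgeSet hf.1
  obtain ⟨e, x, hx, y, hy, hxy⟩ := (isConnected_iff_exists_isLink_of_ssubset.1 hG).2 _
    (vertexSet_edgeInduce_subset.ssubset_of_ne hne) ⟨z, hends f hf z hzw.inc_left⟩
  have heB : e ∈ B := by
    by_contra heB
    exact hy (hends e ⟨hxy.edge_mem, heB⟩ y hxy.inc_right)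
  have heT := hmax ⟨Set.insert_subset heB hTB,
    hT.insert_of_isLink hE hk hB.indep hTB heB hxy hx⟩ (Set.mem_insert e T)
  exact hy ⟨e, heT, hxy.inc_right⟩

theorem IsConnected.kIndep_edgeSet (hG : IsConnected G) (hE : E(G).Finite) (hk : 1 ≤ k)
    (hexc : excess G < k) : KIndep G k E(G) := by
  by_contra hdep
  obtain ⟨B, hB⟩ := (kCircularMatroid G hE k hk).exists_isBasis E(G)
  obtain ⟨T, hTB, hT, hV⟩ := hG.exists_isSaturated_spanning hB hdep
  have hTE : T ⊂ E(G) := (hTB.trans hB.subset).ssubset_of_ne fun hTE =>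
    hdep (hB.indep.subset (hTE ▸ hTB))
  have hcard := Set.ncard_lt_ncard hTE hE
  rw [IsSaturated, excess_edgeInduce hTE.1, hV] at hT
  rw [excess] at hexc
  omega

theorem IsConnected.eRank_add_one (hG : IsConnected G) (hexc : (k : ℤ) ≤ excess G + 1) :
    (kCircularMatroid G hE k hk).eRank + 1 = V(G).encard + k := by
  have hVfin := hG.finite_vertexSet hE
  rw [← Matroid.eRk_ground]
  refine le_antisymm ((eRk_kCircularMatroid_add_one_le _).trans ?_) ?_
  · have hV := Set.encard_le_encard (vertexSet_edgeInduce_subset (G := G) (X := E(G)))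
    rw [kCircularMatroid_ground]
    gcongr
  by_cases hdep : KIndep G k E(G)
  · have hI : (kCircularMatroid G hE k hk).Indep E(G) := hdep
    rw [kCircularMatroid_ground, hI.eRk_eq_encard, ← hVfin.cast_ncard_eq, ← hE.cast_ncard_eq]
    rw [excess] at hexc
    norm_cast
    omega
  · obtain ⟨B, hB⟩ := (kCircularMatroid G hE k hk).exists_isBasis E(G)
    obtain ⟨T, hTB, hT, hV⟩ := hG.exists_isSaturated_spanning hB hdep
    have hTE := hTB.trans hB.subset
    rw [← hV, ← hT.encard_add_one hE hTE]
    gcongr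
    exact (hB.indep.subset hTB).encard_le_eRk_of_subset hTE

theorem IsConnected.corank_add (hG : IsConnected G) (hexc : (k : ℤ) ≤ excess G + 1) :
    corank G hE k hk + (V(G).ncard + k) = E(G).ncard + 1 := by
  have hdual := (kCircularMatroid G hE k hk).eRank_add_eRank_dual
  have hrank := hG.eRank_add_one hexc (hE := hE) (hk := hk)
  rw [kCircularMatroid_ground, ← hE.cast_ncard_eq] at hdual
  rw [(hG.finite_vertexSet hE).cast_ncard_eq, ← hrank, ← hdual, corank]
  ring

theorem IsConnected.isKSmall_iff (hG : IsConnected G) (hexc : (k : ℤ) ≤ excess G + 1) {x : α}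
    (hx : x ∈ V(G)) : IsKSmall G hE k hk x ↔ (k : ℤ) ≤ excess (G.deleteVerts {x}) := by
  have hcorank := hG.corank_add hexc (hE := hE) (hk := hk)
  have hdel := excess_deleteVerts_singleton (hG.finite_vertexSet hE) hE hx
  rw [IsKSmall, ← (hE.subset (G.incidenceSet_subset_edgeSet x)).cast_ncard_eq]
  rw [show excess G = (E(G).ncard : ℤ) - V(G).ncard from rfl] at hdel hexc
  generalize corank G hE k hk = r at hcorank ⊢
  enat_to_nat
  omega

theorem IsConnected.isKTight_iff (hG : IsConnected G) (hexc : (k : ℤ) ≤ excess G + 1) {x : α}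
    (hx : x ∈ V(G)) : IsKTight G hE k hk x ↔ excess (G.deleteVerts {x}) + 1 = k := by
  have hcorank := hG.corank_add hexc (hE := hE) (hk := hk)
  have hdel := excess_deleteVerts_singleton (hG.finite_vertexSet hE) hE hx
  rw [IsKTight, ← (hE.subset (G.incidenceSet_subset_edgeSet x)).cast_ncard_eq]
  rw [show excess G = (E(G).ncard : ℤ) - V(G).ncard from rfl] at hdel hexc
  generalize corank G hE k hk = r at hcorank ⊢
  enat_to_nat
  omega

end Connected

section VertexConnected

variable {n : ℕ}

/-- `G` is `n`-connected: it has more than `n` vertices and deleting fewer than `n` of them leaves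
a connected graph. Unlike `IsThreeConnected`, this does not exclude loops. -/
def IsVertexConnected (n : ℕ) (G : Graph α β) : Prop :=
  n < V(G).encard ∧ ∀ X ⊆ V(G), X.encard < n → IsConnected (G.deleteVerts X)

theorem IsThreeConnected.isVertexConnected (hG : IsThreeConnected G) : IsVertexConnected 3 G :=
  ⟨lt_of_lt_of_le (by norm_num) hG.2.1, hG.2.2⟩

theorem IsVertexConnected.mono {m : ℕ} (hmn : m ≤ n) (hG : IsVertexConnected n G) :
    IsVertexConnected m G :=
  have hmn : (m : ℕ∞) ≤ n := Nat.cast_le.2 hmn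
  ⟨hmn.trans_lt hG.1, fun X hXV hX => hG.2 X hXV (hX.trans_le hmn)⟩

theorem IsVertexConnected.isConnected (hn : 0 < n) (hG : IsVertexConnected n G) :
    IsConnected G := by
  simpa using hG.2 ∅ (Set.empty_subset _) (by simpa using hn)

theorem IsVertexConnected.deleteVerts_singleton (hG : IsVertexConnected (n + 1) G) {x : α}
    (hx : x ∈ V(G)) : IsVertexConnected n (G.deleteVerts {x}) := by
  refine ⟨?_, fun X hXV hX => ?_⟩
  · have hcard := Set.encard_sdiff_singleton_add_one hx
    have hn := hG.1
    rw [← hcard, Nat.cast_add_one] at hn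
    rw [vertexSet_deleteVerts]
    exact lt_of_add_lt_add_right hn
  · have hdel : (G.deleteVerts {x}).deleteVerts X = G.deleteVerts (insert x X) := by
      refine Graph.ext (by simp [Set.sdiff_sdiff]) fun e a b => ?_
      simp only [deleteVerts_isLink, Set.mem_singleton_iff, Set.mem_insert_iff]
      tauto
    rw [vertexSet_deleteVerts] at hXV
    rw [hdel]
    refine hG.2 _ (Set.insert_subset hx (hXV.trans Set.sdiff_subset)) ?_
    rw [Set.encard_insert_of_notMem fun hxX => (hXV hxX).2 rfl, Nat.cast_add_one]
    exact (ENat.add_lt_add_iff_right ENat.one_ne_top).2 hX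

theorem IsVertexConnected.exists_isLink_notMem (hG : IsVertexConnected n G) {x : α}
    (hx : x ∈ V(G)) {D : Set α} (hD : D.encard < n) :
    ∃ e y, G.IsLink e x y ∧ y ≠ x ∧ y ∉ D := by
  have hDx : ((D ∩ V(G)) \ {x}).encard ≤ D.encard :=
    Set.encard_le_encard (Set.sdiff_subset.trans Set.inter_subset_left)
  have hconn := hG.2 _ (Set.sdiff_subset.trans Set.inter_subset_right) (hDx.trans_lt hD)
  have hlt : (insert x (D ∩ V(G))).encard < V(G).encard := by
    refine ((Set.encard_insert_le _ _).trans ?_).trans_lt hG.1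
    exact (add_le_add_left (Set.encard_le_encard Set.inter_subset_left) 1).trans
      (Order.add_one_le_of_lt hD)
  have ⟨z, hz, hzD⟩ : (V(G) \ insert x (D ∩ V(G))).Nonempty :=
    Set.sdiff_nonempty.2 fun hsub => (Set.encard_le_encard hsub).not_gt hlt
  rw [Set.mem_insert_iff, not_or] at hzD
  obtain ⟨e, _, rfl, y, hy, hxy⟩ := (isConnected_iff_exists_isLink_of_ssubset.1 hconn).2 {x}
    ⟨by simpa using hx, fun hsub => hzD.1 (hsub ⟨hz, fun hzD' => hzD.2 hzD'.1⟩)⟩ ⟨x, rfl⟩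
  rw [deleteVerts_isLink] at hxy
  exact ⟨e, y, hxy.1, hy, fun hyD => hxy.2.2 ⟨⟨hyD, hxy.1.right_mem⟩, hy⟩⟩

theorem IsVertexConnected.incidenceSet_injOn (hG : IsVertexConnected 2 G) :
    Set.InjOn G.incidenceSet V(G) := by
  intro x hx y _ hxy
  by_contra hne
  obtain ⟨e, z, hxz, -, hzy⟩ := hG.exists_isLink_notMem hx (D := {y})
    (by rw [Set.encard_singleton]; norm_num)
  have hey : G.Inc e y := hxy.subset hxz.inc_left
  exact (hey.eq_or_eq_of_isLink hxz).elim (Ne.symm hne) (Ne.symm hzy)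

theorem IsVertexConnected.isConnected_deleteEdges_singleton (hG : IsVertexConnected 2 G) {e : β}
    (he : e ∈ E(G)) : IsConnected (G.deleteEdges {e}) := by
  obtain ⟨x, y, hxy⟩ := G.exists_isLink_of_mem_edgeSet he
  obtain ⟨f, z, hxz, hzx, hzy⟩ := hG.exists_isLink_notMem hxy.left_mem (D := {y})
    (by rw [Set.encard_singleton]; norm_num)
  have hfe : f ≠ e := by
    rintro rfl
    exact (hxz.right_eq_or_eq hxy).elim hzx hzy
  have hdel : (G.deleteEdges {e}).deleteVerts {x} = G.deleteVerts {x} := by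
    refine Graph.ext rfl fun g a b => ?_
    simp only [deleteVerts_isLink, deleteEdges_isLink, Set.mem_singleton_iff]
    refine and_congr_left fun ⟨ha, hb⟩ => and_iff_left_of_imp fun hab hge => ?_
    obtain rfl : g = e := hge
    exact (hxy.left_eq_or_eq hab).elim (fun h => ha h.symm) fun h => hb h.symm
  refine IsConnected.of_deleteVerts_singleton (e := f) (hdel ▸ ?_) ⟨hxz, hfe⟩ hzx
  exact hG.2 _ (Set.singleton_subset_iff.2 hxy.left_mem) (by rw [Set.encard_singleton]; norm_num)

theorem IsVertexConnected.one_lt_ncard_incidenceSet (hG : IsVertexConnected 2 G)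
    (hE : E(G).Finite) {x : α} (hx : x ∈ V(G)) : 1 < (G.incidenceSet x).ncard := by
  obtain ⟨e, y, hxy, -⟩ := hG.exists_isLink_notMem hx (D := ∅) (by simp)
  obtain ⟨f, z, hxz, -, hzy⟩ := hG.exists_isLink_notMem hx (D := {y})
    (by rw [Set.encard_singleton]; norm_num)
  rw [Set.one_lt_ncard (hE.subset (G.incidenceSet_subset_edgeSet x))]
  refine ⟨e, hxy.inc_left, f, hxz.inc_left, ?_⟩
  rintro rfl
  exact hzy (hxy.right_unique hxz).symm

theorem IsVertexConnected.excess_deleteVerts_singleton_lt (hG : IsVertexConnected 2 G)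
    (hE : E(G).Finite) {x : α} (hx : x ∈ V(G)) : excess (G.deleteVerts {x}) < excess G := by
  have hdel := excess_deleteVerts_singleton ((hG.isConnected two_pos).finite_vertexSet hE) hE hx
  have hstar := hG.one_lt_ncard_incidenceSet hE hx
  omega

theorem IsVertexConnected.le_excess (hG : IsVertexConnected 2 G) (hE : E(G).Finite)
    (hexcx : ∀ x ∈ V(G), (k : ℤ) ≤ excess (G.deleteVerts {x}) + 1) : k ≤ excess G :=
  have ⟨x, hx⟩ := (hG.isConnected two_pos).nonempty
  (hexcx x hx).trans (hG.excess_deleteVerts_singleton_lt hE hx)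

theorem isCyclicSet_edgeSet_of_le (hHG : H ≤ G)
    (hH : ∀ e ∈ E(H), IsConnected (H.deleteEdges {e})) (hexc : (k : ℤ) ≤ excess H) :
    IsCyclicSet (kCircularMatroid G hE k hk) E(H) := by
  intro e he
  have hEH := hE.subset hHG.edgeSet_mono
  have hJH : H.deleteEdges {e} ≤s H := ⟨deleteEdges_le, rfl⟩
  have hHconn : IsConnected H := (hH e he).of_isSpanningSubgraph hJH
  have hJexc : excess (H.deleteEdges {e}) + 1 = excess H := by
    have hcard := Set.ncard_sdiff_singleton_add_one he hEH
    rw [excess, excess, vertexSet_deleteEdges, edgeSet_deleteEdges]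
    omega
  have hJrank := (hH e he).eRank_add_one (hE := hEH.subset hJH.le.edgeSet_mono) (hk := hk)
    (by omega)
  have hHrank := hHconn.eRank_add_one (hE := hEH) (hk := hk) (by omega)
  rw [← eRk_kCircularMatroid_edgeSet (hE := hE) (hJH.le.trans hHG), hJH.vertexSet_eq,
    ← hHrank, ← eRk_kCircularMatroid_edgeSet (hE := hE) hHG] at hJrank
  have hrank := ENat.add_left_injective_of_ne_top ENat.one_ne_top hJrank
  rw [edgeSet_deleteEdges] at hrank
  have hfin : (kCircularMatroid G hE k hk).IsRkFinite (E(H) \ {e}) :=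
    Matroid.isRkFinite_of_finite _ (hEH.subset Set.sdiff_subset)
  rw [hfin.closure_eq_closure_of_subset_of_eRk_ge_eRk Set.sdiff_subset hrank.ge]
  exact Matroid.mem_closure_of_mem' _ he (hHG.edgeSet_mono he)

end VertexConnected

section Uniqueness

variable {α' : Type*} {G' : Graph α' β} {hE' : E(G').Finite}

theorem eRk_insert_eq_add_one_of_notMem_vertexSet {X : Set β} {f : β} {x : α}
    (hf : G.Inc f x) (hx : x ∉ V(edgeInduce G X)) :
    (kCircularMatroid G hE k hk).eRk (insert f X) = (kCircularMatroid G hE k hk).eRk X + 1 := by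
  refine Matroid.eRk_insert_eq_add_one ⟨hf.edge_mem, fun hfX => ?_⟩
  obtain ⟨B, hB⟩ := (kCircularMatroid G hE k hk).exists_isBasis' X
  have hBV := vertexSet_edgeInduce_mono G hB.subset
  have hfB : f ∉ B := fun hfB => hx (hBV ⟨f, hfB, hf⟩)
  rw [← hB.closure_eq_closure, hB.indep.mem_closure_iff_of_notMem hfB] at hfX
  obtain ⟨T, hTB, -, hfT⟩ :=
    KIndep.exists_isSaturated_of_not_kIndep_insert hE hB.indep hf.edge_mem hfX.not_indep
  exact hx (hBV (vertexSet_edgeInduce_mono G hTB (hfT x hf)))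

theorem exists_incidenceSet_subset (hM : kCircularMatroid G' hE' k hk = kCircularMatroid G hE k hk)
    (hV : V(G).Finite) (hcard : V(G').encard = V(G).encard) {x : α} (hx : x ∈ V(G))
    (hcyc : IsCyclicSet (kCircularMatroid G hE k hk) E(G.deleteVerts {x}))
    (hne : E(G.deleteVerts {x}).Nonempty) :
    ∃ x' ∈ V(G'), G'.incidenceSet x' ⊆ G.incidenceSet x := by
  have hEE : E(G') = E(G) := congrArg Matroid.E hM
  have hsub : V(edgeInduce G E(G.deleteVerts {x})) ⊆ V(G) \ {x} := by
    rw [← edgeInduce_of_le deleteVerts_le subset_rfl, ← vertexSet_deleteVerts]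
    exact vertexSet_edgeInduce_subset
  have hlt : V(edgeInduce G' E(G.deleteVerts {x})).encard < V(G').encard := by
    rw [hcyc.encard_vertexSet_edgeInduce_eq hM hne, hcard]
    exact (Set.encard_le_encard hsub).trans_lt
      ((hV.subset Set.sdiff_subset).encard_lt_encard (Set.sdiff_singleton_ssubset.2 hx))
  have ⟨x', hx', hx'X⟩ : (V(G') \ V(edgeInduce G' E(G.deleteVerts {x}))).Nonempty :=
    Set.sdiff_nonempty.2 fun h => (Set.encard_le_encard h).not_gt hlt
  refine ⟨x', hx', fun e he => ?_⟩
  by_contra hex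
  refine hx'X ⟨e, ?_, he⟩
  rw [edgeSet_deleteVerts_singleton, ← hEE]
  exact ⟨G'.incidenceSet_subset_edgeSet x' he, hex⟩

theorem incidenceSet_eq_of_subset (hM : kCircularMatroid G' hE' k hk = kCircularMatroid G hE k hk)
    (hV : V(G).Finite) (hcard : V(G').encard = V(G).encard) {x : α} (hx : x ∈ V(G))
    (hconn : IsConnected (G.deleteVerts {x})) (hexc : (k : ℤ) ≤ excess (G.deleteVerts {x}) + 1)
    {x' : α'} (hx' : x' ∈ V(G')) (hsub : G'.incidenceSet x' ⊆ G.incidenceSet x) :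
    G'.incidenceSet x' = G.incidenceSet x := by
  refine hsub.antisymm fun f hf => ?_
  by_contra hfx'
  have hxV : x ∉ V(edgeInduce G E(G.deleteVerts {x})) := fun ⟨_, he, hex⟩ =>
    notMem_edgeSet_deleteVerts_singleton hex he
  have hrank : (kCircularMatroid G' hE' k hk).eRk (insert f E(G.deleteVerts {x})) + 1 =
      V(G).encard + k := by
    rw [hM, eRk_insert_eq_add_one_of_notMem_vertexSet hf hxV,
      eRk_kCircularMatroid_edgeSet deleteVerts_le, hconn.eRank_add_one hexc,
      vertexSet_deleteVerts, ← Set.encard_sdiff_singleton_add_one hx]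
    ring
  have hV'sub : V(edgeInduce G' (insert f E(G.deleteVerts {x}))) ⊆ V(G') \ {x'} := by
    refine Set.subset_sdiff_singleton vertexSet_edgeInduce_subset ?_
    rintro ⟨e, rfl | he, hex'⟩
    exacts [hfx' hex', notMem_edgeSet_deleteVerts_singleton (hsub hex') he]
  have hle := (eRk_kCircularMatroid_add_one_le (hE := hE') (hk := hk) _).trans
    (add_le_add_left (Set.encard_le_encard hV'sub) (k : ℕ∞))
  have hV'card := Set.encard_sdiff_singleton_add_one hx'
  rw [hrank, ← hcard, ← hV'card] at hle
  rw [hcard, ← hV.cast_ncard_eq] at hV'card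
  generalize (V(G') \ {x'}).encard = m at hle hV'card
  enat_to_nat
  omega

theorem IsVertexConnected.isCyclicSet_edgeSet (hG : IsVertexConnected 2 H) (hHG : H ≤ G)
    (hexc : (k : ℤ) ≤ excess H) : IsCyclicSet (kCircularMatroid G hE k hk) E(H) :=
  isCyclicSet_edgeSet_of_le hHG (fun _ => hG.isConnected_deleteEdges_singleton) hexc

theorem edgeSet_nonempty_of_excess_pos (h : 0 < excess G) : E(G).Nonempty := by
  rw [excess] at h
  exact Set.nonempty_of_ncard_ne_zero (by omega)

theorem IsVertexConnected.encard_vertexSet_eq (hG : IsVertexConnected 2 G)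
    (hM : kCircularMatroid G' hE' k hk = kCircularMatroid G hE k hk) (hG' : NoIsolatedVertex G')
    (hexc : (k : ℤ) ≤ excess G) : V(G').encard = V(G).encard := by
  have hne : E(G).Nonempty := edgeSet_nonempty_of_excess_pos (by omega)
  have hcyc := hG.isCyclicSet_edgeSet (hE := hE) (hk := hk) le_rfl hexc
  have h := hcyc.encard_vertexSet_edgeInduce_eq hM hne
  have hEE : E(G') = E(G) := congrArg Matroid.E hM
  rwa [← hEE, hG'.vertexSet_edgeInduce_edgeSet, hEE,
    ((hG.isConnected two_pos).noIsolatedVertex hne).vertexSet_edgeInduce_edgeSet] at h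

theorem IsVertexConnected.exists_incidenceSet_eq (hG : IsVertexConnected 3 G)
    (hM : kCircularMatroid G' hE' k hk = kCircularMatroid G hE k hk)
    (hcard : V(G').encard = V(G).encard) {x : α} (hx : x ∈ V(G))
    (hexc : (k : ℤ) ≤ excess (G.deleteVerts {x})) :
    ∃ x' ∈ V(G'), G'.incidenceSet x' = G.incidenceSet x := by
  have hGx := hG.deleteVerts_singleton hx
  have hV := (hG.isConnected three_pos).finite_vertexSet hE
  obtain ⟨x', hx', hsub⟩ := exists_incidenceSet_subset hM hV hcard hx
    (hGx.isCyclicSet_edgeSet deleteVerts_le hexc) (edgeSet_nonempty_of_excess_pos (by omega))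
  exact ⟨x', hx', incidenceSet_eq_of_subset hM hV hcard hx (hGx.isConnected two_pos) (by omega)
    hx' hsub⟩

theorem exists_incidenceSet_subset_of_forall_ne [G.Loopless] (hEE : E(G') = E(G))
    (hV : V(G).Finite) (hinj : Set.InjOn G.incidenceSet V(G))
    (hcard : V(G').encard = V(G).encard) {t : α} (ht : t ∈ V(G))
    (h : ∀ x ∈ V(G), x ≠ t → ∃ x' ∈ V(G'), G'.incidenceSet x' = G.incidenceSet x) :
    ∃ t' ∈ V(G'), G'.incidenceSet t' ⊆ G.incidenceSet t := by
  have ⟨x₀, _⟩ : V(G').Nonempty := Set.encard_pos.1 (hcard ▸ Set.encard_pos.2 ⟨t, ht⟩)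
  have : Nonempty α' := ⟨x₀⟩
  choose! φ _ hφ using h
  have hlt : (φ '' (V(G) \ {t})).encard < V(G').encard := by
    rw [hcard]
    exact (Set.encard_image_le _ _).trans_lt
      ((hV.subset Set.sdiff_subset).encard_lt_encard (Set.sdiff_singleton_ssubset.2 ht))
  have ⟨t', ht', ht'φ⟩ : (V(G') \ φ '' (V(G) \ {t})).Nonempty :=
    Set.sdiff_nonempty.2 fun h => (Set.encard_le_encard h).not_gt hlt
  refine ⟨t', ht', fun e he => ?_⟩
  by_contra het
  obtain ⟨a, b, hab⟩ := G.exists_isLink_of_mem_edgeSet (hEE ▸ G'.incidenceSet_subset_edgeSet t' he)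
  have hat : a ≠ t := fun hat => het (hat ▸ hab.inc_left)
  have hbt : b ≠ t := fun hbt => het (hbt ▸ hab.inc_right)
  have hφa : G'.Inc e (φ a) := (hφ a hab.left_mem hat).ge hab.inc_left
  have hφb : G'.Inc e (φ b) := (hφ b hab.right_mem hbt).ge hab.inc_right
  have hφab : φ a ≠ φ b := fun h => hab.ne <| hinj hab.left_mem hab.right_mem <| by
    rw [← hφ a hab.left_mem hat, h, hφ b hab.right_mem hbt]
  rcases hφa.eq_or_eq_or_eq hφb he with h | h | h
  exacts [hφab h, ht'φ ⟨a, ⟨hab.left_mem, hat⟩, h⟩, ht'φ ⟨b, ⟨hab.right_mem, hbt⟩, h⟩]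

theorem stronglyIsomorphic_of_incidenceSet_eq {α α' : Type u} {G : Graph α β} {G' : Graph α' β}
    (hEE : E(G') = E(G)) (hV : V(G).Finite) (hinj : Set.InjOn G.incidenceSet V(G))
    (hcard : V(G').encard = V(G).encard)
    (h : ∀ x ∈ V(G), ∃ x' ∈ V(G'), G'.incidenceSet x' = G.incidenceSet x) :
    StronglyIsomorphic G G' := by
  choose φ hφV' hφ using h
  let ν : V(G) → V(G') := fun x => ⟨φ x x.2, hφV' x x.2⟩
  have hν : ∀ x e, G'.Inc e (ν x) ↔ G.Inc e x := fun x e => Set.ext_iff.1 (hφ x x.2) e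
  have hνinj : Function.Injective ν := fun x y hxy => Subtype.ext <| hinj x.2 y.2 <|
    Set.ext fun e => (hν x e).symm.trans (hxy ▸ hν y e)
  have hνval : ∀ x y, (ν x : α') = ν y ↔ (x : α) = y := fun x y => by
    rw [Subtype.val_inj, hνinj.eq_iff, Subtype.val_inj]
  have : Finite V(G) := hV
  have : Finite V(G') := Set.encard_ne_top_iff.1 (hcard ▸ Set.encard_ne_top_iff.2 hV)
  have hνbij : Function.Bijective ν :=
    (Nat.bijective_iff_injective_and_card ν).2 ⟨hνinj, congrArg ENat.toNat hcard.symm⟩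
  refine ⟨hEE.symm, Equiv.ofBijective ν hνbij, fun e x y => ?_⟩
  simp only [isLink_iff_inc, Equiv.ofBijective_apply, hν]
  refine and_congr_right' <| and_congr_right' ⟨fun hz z' hz' => ?_, fun hz z hez => ?_⟩
  · obtain ⟨z, hνz⟩ := hνbij.surjective ⟨z', hz'.vertex_mem⟩
    obtain rfl : (ν z : α') = z' := congrArg Subtype.val hνz
    simpa only [hνval] using hz z ((hν z e).1 hz')
  · simpa only [hνval] using hz _ ((hν ⟨z, hez.vertex_mem⟩ e).2 hez)

theorem IsVertexConnected.uniquelyDefined {α : Type u} {G : Graph α β} [G.Loopless]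
    {hE : E(G).Finite} (hG : IsVertexConnected 3 G)
    (hexcx : ∀ x ∈ V(G), (k : ℤ) ≤ excess (G.deleteVerts {x}) + 1)
    (hsub : {x ∈ V(G) | excess (G.deleteVerts {x}) < k}.Subsingleton) :
    UniquelyDefined G hE k hk := by
  intro α' G' _ hE' hG' hM
  have hEE : E(G') = E(G) := congrArg Matroid.E hM
  have hV := (hG.isConnected three_pos).finite_vertexSet hE
  have hG₂ : IsVertexConnected 2 G := hG.mono (by norm_num)
  have hcard := hG₂.encard_vertexSet_eq hM hG' (hG₂.le_excess hE hexcx)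
  refine stronglyIsomorphic_of_incidenceSet_eq hEE hV hG₂.incidenceSet_injOn hcard fun t ht => ?_
  by_cases htk : (k : ℤ) ≤ excess (G.deleteVerts {t})
  · exact hG.exists_incidenceSet_eq hM hcard ht htk
  have hne : ∀ x ∈ V(G), x ≠ t → ∃ x' ∈ V(G'), G'.incidenceSet x' = G.incidenceSet x := by
    intro x hx hxt
    refine hG.exists_incidenceSet_eq hM hcard hx ?_
    by_contra! hxk
    exact hxt (hsub ⟨hx, hxk⟩ ⟨ht, not_le.1 htk⟩)
  obtain ⟨t', ht', hsub⟩ := exists_incidenceSet_subset_of_forall_ne hEE hV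
    hG₂.incidenceSet_injOn hcard ht hne
  exact ⟨t', ht', incidenceSet_eq_of_subset hM hV hcard ht
    ((hG.deleteVerts_singleton ht).isConnected two_pos) (hexcx t ht) ht' hsub⟩

end Uniqueness

section NonUniqueness

variable {G' : Graph α β} {hE' : E(G').Finite} {D : Set β} {φ : α → α}

theorem KIndep.of_deleteVerts (hE : E(G).Finite) (hk : 1 ≤ k) (hEE : E(G') = E(G)) {S : Set α}
    (hS : ∀ x ∈ S, KIndep G' k E(G'.deleteVerts {x}))
    (hinc : ∀ e, ∀ x ∉ S, G.Inc e x → G'.Inc e x) {I : Set β} (hI : KIndep G k I) :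
    KIndep G' k I := by
  have hE' : E(G').Finite := hEE ▸ hE
  rw [kIndep_iff hE' hk, hEE]
  refine ⟨hI.1, fun X hXI => ?_⟩
  have hXE := hXI.trans hI.1
  by_cases hSX : S ⊆ V(edgeInduce G' X)
  · have hV : V(edgeInduce G X) ⊆ V(edgeInduce G' X) := by
      rintro x ⟨e, he, hex⟩
      by_cases hxS : x ∈ S
      exacts [hSX hxS, ⟨e, he, hinc e x hxS hex⟩]
    have hexc := ((kIndep_iff hE hk).1 hI).2 X hXI
    have hcard := Set.ncard_le_ncard hV (vertexSet_edgeInduce_finite G' (hE.subset hXE))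
    rw [excess_edgeInduce hXE] at hexc
    rw [excess_edgeInduce (hEE ▸ hXE)]
    omega
  · obtain ⟨x, hxS, hxX⟩ := Set.not_subset.1 hSX
    refine ((kIndep_iff hE' hk).1 (hS x hxS)).2 X fun e he => ?_
    rw [edgeSet_deleteVerts_singleton, hEE]
    exact ⟨hXE he, fun hex => hxX ⟨e, he, hex⟩⟩

theorem kCircularMatroid_eq_of_deleteVerts (hEE : E(G') = E(G)) {S : Set α}
    (hS : ∀ x ∈ S, KIndep G k E(G.deleteVerts {x}))
    (hS' : ∀ x ∈ S, KIndep G' k E(G'.deleteVerts {x}))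
    (hinc : ∀ e, ∀ x ∉ S, G'.Inc e x ↔ G.Inc e x) :
    kCircularMatroid G' hE' k hk = kCircularMatroid G hE k hk :=
  Matroid.ext_indep hEE fun _ _ =>
    ⟨KIndep.of_deleteVerts hE' hk hEE.symm hS fun e x hx => (hinc e x hx).1,
      KIndep.of_deleteVerts hE hk hEE hS' fun e x hx => (hinc e x hx).2⟩

theorem IsConnected.kIndep_edgeSet_of_le (hH : IsConnected H) (hHG : H ≤ G) (hE : E(G).Finite)
    (hk : 1 ≤ k) (hexc : excess H < k) : KIndep G k E(H) :=
  (kIndep_iff_of_le hHG subset_rfl).1 (hH.kIndep_edgeSet (hE.subset hHG.edgeSet_mono) hk hexc)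

/-- The graph obtained from `G` by moving the ends of the edges in `D` along `φ`. The values of `φ`
are added to the vertices, so that `φ` need not map vertices to vertices. -/
def moveEnds (G : Graph α β) (D : Set β) (φ : α → α) : Graph α β where
  vertexSet := V(G) ∪ φ '' V(G)
  edgeSet := E(G)
  IsLink e x y := e ∉ D ∧ G.IsLink e x y ∨ e ∈ D ∧ ∃ a b, G.IsLink e a b ∧ φ a = x ∧ φ b = y
  isLink_symm e _ := by
    refine ⟨?_⟩
    rintro x y (⟨he, h⟩ | ⟨he, a, b, h, hx, hy⟩)
    exacts [Or.inl ⟨he, h.symm⟩, Or.inr ⟨he, b, a, h.symm, hy, hx⟩]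
  eq_or_eq_of_isLink_of_isLink := by
    rintro e x y v w (⟨he, h⟩ | ⟨he, a, b, h, rfl, rfl⟩) (⟨he', h'⟩ | ⟨he', c, d, h', rfl, rfl⟩)
    exacts [h.left_eq_or_eq h', absurd he' he, absurd he he',
      (h.left_eq_or_eq h').imp (congrArg φ) (congrArg φ)]
  edge_mem_iff_exists_isLink e := by
    refine ⟨fun he => ?_, ?_⟩
    · obtain ⟨a, b, h⟩ := G.exists_isLink_of_mem_edgeSet he
      by_cases heD : e ∈ D
      exacts [⟨φ a, φ b, Or.inr ⟨heD, a, b, h, rfl, rfl⟩⟩, ⟨a, b, Or.inl ⟨heD, h⟩⟩]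
    · rintro ⟨x, y, ⟨-, h⟩ | ⟨-, a, b, h, -⟩⟩ <;> exact h.edge_mem
  left_mem_of_isLink := by
    rintro e x y (⟨-, h⟩ | ⟨-, a, b, h, rfl, -⟩)
    exacts [Or.inl h.left_mem, Or.inr ⟨a, h.left_mem, rfl⟩]

theorem vertexSet_moveEnds (hφ : Set.MapsTo φ V(G) V(G)) : V(moveEnds G D φ) = V(G) :=
  Set.union_eq_self_of_subset_right hφ.image_subset

theorem excess_moveEnds (hφ : Set.MapsTo φ V(G) V(G)) : excess (moveEnds G D φ) = excess G := by
  rw [excess, vertexSet_moveEnds hφ]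
  rfl

theorem moveEnds_isLink_of_notMem {e : β} (he : e ∉ D) {x y : α} :
    (moveEnds G D φ).IsLink e x y ↔ G.IsLink e x y :=
  ⟨fun h => h.elim And.right fun h => absurd h.1 he, fun h => Or.inl ⟨he, h⟩⟩

theorem moveEnds_inc_of_notMem {e : β} (he : e ∉ D) {x : α} :
    (moveEnds G D φ).Inc e x ↔ G.Inc e x :=
  exists_congr fun _ => moveEnds_isLink_of_notMem he

theorem moveEnds_inc_of_mem {e : β} (he : e ∈ D) {x : α} :
    (moveEnds G D φ).Inc e x ↔ ∃ a, G.Inc e a ∧ φ a = x := by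
  constructor
  · rintro ⟨y, ⟨heD, -⟩ | ⟨-, a, b, h, hx, -⟩⟩
    exacts [absurd he heD, ⟨a, h.inc_left, hx⟩]
  · rintro ⟨a, ⟨b, h⟩, hx⟩
    exact ⟨φ b, Or.inr ⟨he, a, b, h, hx, rfl⟩⟩

theorem moveEnds_perm_inc_of_mem {σ : Equiv.Perm α} {e : β} (he : e ∈ D) {x : α} :
    (moveEnds G D σ).Inc e (σ x) ↔ G.Inc e x := by
  simp only [moveEnds_inc_of_mem he, EmbeddingLike.apply_eq_iff_eq, exists_eq_right]

theorem isSpanningSubgraph_deleteVerts_moveEnds (hHG : H ≤ G) (hφ : Set.MapsTo φ V(G) V(G))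
    {X : Set α} (hV : V(H) = V(G) \ X) (hD : Disjoint E(H) D) :
    H ≤s (moveEnds G D φ).deleteVerts X := by
  have hV' : V(H) = V((moveEnds G D φ).deleteVerts X) := by
    rw [hV, vertexSet_deleteVerts, vertexSet_moveEnds hφ]
  refine ⟨⟨hV'.le, fun e x y hxy => (deleteVerts_isLink _ _).2 ⟨?_, ?_, ?_⟩⟩, hV'⟩
  · exact (moveEnds_isLink_of_notMem (hD.notMem_of_mem_left hxy.edge_mem)).2 (hxy.mono hHG)
  · exact (hV.le hxy.left_mem).2
  · exact (hV.le hxy.right_mem).2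

theorem IsConnected.kIndep_edgeSet_deleteVerts_moveEnds (hH : IsConnected H) (hHG : H ≤ G)
    (hφ : Set.MapsTo φ V(G) V(G)) (hV : V(G).Finite) (hE : E(G).Finite) (hk : 1 ≤ k) {x : α}
    (hx : x ∈ V(G)) (hHV : V(H) = V(G) \ {x}) (hHD : Disjoint E(H) D)
    (hexc : excess G + 1 < k + ((moveEnds G D φ).incidenceSet x).ncard) :
    KIndep (moveEnds G D φ) k E((moveEnds G D φ).deleteVerts {x}) := by
  have hV' := vertexSet_moveEnds (D := D) hφ
  have hdel := excess_deleteVerts_singleton (G := moveEnds G D φ) (hV' ▸ hV) hE (hV' ▸ hx)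
  rw [excess_moveEnds hφ] at hdel
  exact (hH.of_isSpanningSubgraph (isSpanningSubgraph_deleteVerts_moveEnds hHG hφ hHV hHD))
    |>.kIndep_edgeSet_of_le deleteVerts_le hE hk (by omega)

theorem StronglyIsomorphic.exists_incidenceSet_eq (h : StronglyIsomorphic G G') {x : α}
    (hx : x ∈ V(G)) : ∃ x', G'.incidenceSet x' = G.incidenceSet x := by
  obtain ⟨-, ν, hν⟩ := h
  refine ⟨ν ⟨x, hx⟩, Set.ext fun e => ⟨fun ⟨y, hy⟩ => ?_, fun ⟨y, hy⟩ => ?_⟩⟩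
  · obtain ⟨y, rfl⟩ : ∃ z, (ν z : α) = y := ⟨ν.symm ⟨y, hy.right_mem⟩, by simp⟩
    exact ((hν e _ y).2 hy).inc_left
  · exact ((hν e ⟨x, hx⟩ ⟨y, hy.right_mem⟩).1 hy).inc_left

theorem StronglyIsomorphic.loopless [G.Loopless] (h : StronglyIsomorphic G G') :
    G'.Loopless := by
  obtain ⟨-, ν, hν⟩ := h
  refine ⟨fun e x hx => ?_⟩
  obtain ⟨y, rfl⟩ : ∃ z, (ν z : α) = x := ⟨ν.symm ⟨x, hx.left_mem⟩, by simp⟩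
  exact G.not_isLoopAt e y ((hν e y y).2 hx)

theorem moveEnds_const_inc {e : β} {x y z : α} (hex : G.Inc e x) :
    (moveEnds G {e} fun _ => y).Inc e z ↔ y = z :=
  (moveEnds_inc_of_mem rfl).trans ⟨fun ⟨_, _, h⟩ => h, fun h => ⟨x, hex, h⟩⟩

theorem moveEnds_const_inc_of_ne {e f : β} {x y z : α} (hxy : G.IsLink e x y) (hzx : z ≠ x) :
    (moveEnds G {e} fun _ => y).Inc f z ↔ G.Inc f z := by
  rcases eq_or_ne f e with rfl | hfe
  · rw [moveEnds_const_inc hxy.inc_left]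
    exact ⟨fun h => h ▸ hxy.inc_right, fun h => ((h.eq_or_eq_of_isLink hxy).resolve_left hzx).symm⟩
  · exact moveEnds_inc_of_notMem (D := {e}) hfe

theorem incidenceSet_moveEnds_const {e : β} {x y : α} (hex : G.Inc e x) (hyx : y ≠ x) :
    (moveEnds G {e} fun _ => y).incidenceSet x = G.incidenceSet x \ {e} := by
  ext f
  rcases eq_or_ne f e with rfl | hfe
  · simp [moveEnds_const_inc hex, hyx]
  · simp [moveEnds_inc_of_notMem (D := {e}) hfe, hfe]

theorem IsVertexConnected.not_uniquelyDefined_of_excess_add_one_lt [G.Loopless]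
    (hG : IsVertexConnected 2 G) {x : α} (hx : x ∈ V(G))
    (hexc : excess (G.deleteVerts {x}) + 1 < k) : ¬ UniquelyDefined G hE k hk := by
  intro hU
  have hV := (hG.isConnected two_pos).finite_vertexSet hE
  obtain ⟨e, y, hxy, hyx, -⟩ := hG.exists_isLink_notMem hx (D := ∅) (by simp)
  have hφ : Set.MapsTo (fun _ => y) V(G) V(G) := fun _ _ => hxy.right_mem
  let G' := moveEnds G {e} fun _ => y
  have hV' : V(G') = V(G) := vertexSet_moveEnds hφ
  have hstar : G'.incidenceSet x = G.incidenceSet x \ {e} :=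
    incidenceSet_moveEnds_const hxy.inc_left hyx
  have hcard := Set.ncard_sdiff_singleton_add_one (s := G.incidenceSet x) hxy.inc_left
    (hE.subset (G.incidenceSet_subset_edgeSet x))
  have hdel := excess_deleteVerts_singleton hV hE hx
  have hGx : IsConnected (G.deleteVerts {x}) := (hG.deleteVerts_singleton hx).isConnected one_pos
  have hM : kCircularMatroid G' hE k hk = kCircularMatroid G hE k hk := by
    refine kCircularMatroid_eq_of_deleteVerts rfl (S := {x}) ?_ ?_
      fun _ _ => moveEnds_const_inc_of_ne hxy <;> rintro _ rfl
    · exact hGx.kIndep_edgeSet_of_le deleteVerts_le hE hk (by omega)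
    · refine hGx.kIndep_edgeSet_deleteVerts_moveEnds deleteVerts_le hφ hV hE hk hx
        (vertexSet_deleteVerts _ _) ?_ (hstar ▸ by omega)
      exact Set.disjoint_singleton_right.2 (notMem_edgeSet_deleteVerts_singleton hxy.inc_left)
  have hconn' : IsConnected G' := by
    refine (hG.isConnected_deleteEdges_singleton hxy.edge_mem).of_isSpanningSubgraph ?_
    rw [← deleteVerts_empty G']
    exact isSpanningSubgraph_deleteVerts_moveEnds deleteEdges_le hφ (by simp) (by simp)
  have hiso := hU α G' (hV' ▸ hV) hE (hconn'.noIsolatedVertex ⟨e, hxy.edge_mem⟩) hM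
  exact hiso.loopless.not_isLoopAt e y (Or.inr ⟨rfl, x, y, hxy, rfl, rfl⟩)

end NonUniqueness

section Swap

variable {D : Set β} {e₁ e₂ : β} {x₁ x₂ : α}

theorem mapsTo_swap [DecidableEq α] {S : Set α} (h₁ : x₁ ∈ S) (h₂ : x₂ ∈ S) :
    Set.MapsTo (Equiv.swap x₁ x₂) S S := by
  intro z hz
  rw [Equiv.swap_apply_def]
  split_ifs <;> assumption

theorem moveEnds_swap_inc_of_ne [DecidableEq α] {e : β} {z : α} (hz₁ : z ≠ x₁) (hz₂ : z ≠ x₂) :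
    (moveEnds G D (Equiv.swap x₁ x₂)).Inc e z ↔ G.Inc e z := by
  by_cases he : e ∈ D
  · simpa only [Equiv.swap_apply_of_ne_of_ne hz₁ hz₂] using
      moveEnds_perm_inc_of_mem (G := G) (σ := Equiv.swap x₁ x₂) he (x := z)
  · exact moveEnds_inc_of_notMem he

theorem incidenceSet_moveEnds_swap [DecidableEq α] (h₂₂ : G.Inc e₂ x₂) (h₁₂ : ¬ G.Inc e₁ x₂) :
    (moveEnds G {e₁, e₂} (Equiv.swap x₁ x₂)).incidenceSet x₁ =
      insert e₂ (G.incidenceSet x₁ \ {e₁}) := by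
  ext e
  by_cases he : e ∈ ({e₁, e₂} : Set β)
  · have hinc := moveEnds_perm_inc_of_mem (G := G) (σ := Equiv.swap x₁ x₂) he (x := x₂)
    rw [Equiv.swap_apply_right] at hinc
    rw [mem_incidenceSet, hinc]
    obtain rfl | rfl := he
    · have hne : e ≠ e₂ := fun h => h₁₂ (h ▸ h₂₂)
      simp [h₁₂, hne]
    · simp [h₂₂]
  · rw [mem_incidenceSet, moveEnds_inc_of_notMem he]
    rw [Set.mem_insert_iff, Set.mem_singleton_iff, not_or] at he
    simp [he]

theorem IsVertexConnected.kIndep_edgeSet_deleteVerts_moveEnds_swap [DecidableEq α]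
    (hG : IsVertexConnected 3 G) (hE : E(G).Finite) (hk : 1 ≤ k)
    (h₁₁ : G.Inc e₁ x₁) (h₁₂ : ¬ G.Inc e₁ x₂) (h₂₁ : ¬ G.Inc e₂ x₁) (h₂₂ : G.Inc e₂ x₂)
    (hexc : excess (G.deleteVerts {x₁}) < k) :
    KIndep (moveEnds G {e₁, e₂} (Equiv.swap x₁ x₂)) k
      E((moveEnds G {e₁, e₂} (Equiv.swap x₁ x₂)).deleteVerts {x₁}) := by
  have hV := (hG.isConnected three_pos).finite_vertexSet hE
  have hx₁ := h₁₁.vertex_mem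
  have he₂ : e₂ ∈ E(G.deleteVerts {x₁}) := by
    rw [edgeSet_deleteVerts_singleton]
    exact ⟨h₂₂.edge_mem, h₂₁⟩
  have hconn : IsConnected ((G.deleteVerts {x₁}).deleteEdges {e₂}) :=
    (hG.deleteVerts_singleton hx₁).isConnected_deleteEdges_singleton he₂
  have hstar : ((moveEnds G {e₁, e₂} (Equiv.swap x₁ x₂)).incidenceSet x₁).ncard =
      (G.incidenceSet x₁).ncard := by
    rw [incidenceSet_moveEnds_swap h₂₂ h₁₂]
    exact Set.ncard_exchange h₂₁ h₁₁
  have hdel := excess_deleteVerts_singleton hV hE hx₁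
  refine hconn.kIndep_edgeSet_deleteVerts_moveEnds (deleteEdges_le.trans deleteVerts_le)
    (mapsTo_swap hx₁ h₂₂.vertex_mem) hV hE hk hx₁ (by simp) ?_ (by omega)
  rw [edgeSet_deleteEdges, Set.disjoint_insert_right, Set.disjoint_singleton_right]
  exact ⟨fun h => notMem_edgeSet_deleteVerts_singleton h₁₁ h.1, fun h => h.2 rfl⟩

theorem IsVertexConnected.kCircularMatroid_moveEnds_swap [DecidableEq α]
    (hG : IsVertexConnected 3 G)
    (h₁₁ : G.Inc e₁ x₁) (h₁₂ : ¬ G.Inc e₁ x₂) (h₂₁ : ¬ G.Inc e₂ x₁) (h₂₂ : G.Inc e₂ x₂)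
    (hexc₁ : excess (G.deleteVerts {x₁}) < k) (hexc₂ : excess (G.deleteVerts {x₂}) < k) :
    kCircularMatroid (moveEnds G {e₁, e₂} (Equiv.swap x₁ x₂)) hE k hk =
      kCircularMatroid G hE k hk := by
  refine kCircularMatroid_eq_of_deleteVerts rfl (S := {x₁, x₂}) ?_ ?_ fun e z hz => ?_
  · have hG₂ : IsVertexConnected 2 G := hG.mono (by norm_num)
    rintro _ (rfl | rfl)
    exacts [((hG₂.deleteVerts_singleton h₁₁.vertex_mem).isConnected one_pos).kIndep_edgeSet_of_le
        deleteVerts_le hE hk hexc₁,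
      ((hG₂.deleteVerts_singleton h₂₂.vertex_mem).isConnected one_pos).kIndep_edgeSet_of_le
        deleteVerts_le hE hk hexc₂]
  · rintro _ (rfl | rfl)
    · exact hG.kIndep_edgeSet_deleteVerts_moveEnds_swap hE hk h₁₁ h₁₂ h₂₁ h₂₂ hexc₁
    · rw [Set.pair_comm, Equiv.swap_comm]
      exact hG.kIndep_edgeSet_deleteVerts_moveEnds_swap hE hk h₂₂ h₂₁ h₁₂ h₁₁ hexc₂
  · rw [Set.mem_insert_iff, Set.mem_singleton_iff, not_or] at hz
    exact moveEnds_swap_inc_of_ne hz.1 hz.2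

theorem NoIsolatedVertex.moveEnds_swap [DecidableEq α] (hG : NoIsolatedVertex G)
    (h₁₁ : G.Inc e₁ x₁) (h₁₂ : ¬ G.Inc e₁ x₂) (h₂₁ : ¬ G.Inc e₂ x₁) (h₂₂ : G.Inc e₂ x₂) :
    NoIsolatedVertex (moveEnds G {e₁, e₂} (Equiv.swap x₁ x₂)) := by
  intro z hz
  rw [vertexSet_moveEnds (mapsTo_swap h₁₁.vertex_mem h₂₂.vertex_mem)] at hz
  by_cases hz₁ : z = x₁
  · refine ⟨e₂, ?_⟩
    rw [hz₁, ← mem_incidenceSet, incidenceSet_moveEnds_swap h₂₂ h₁₂]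
    exact Set.mem_insert _ _
  by_cases hz₂ : z = x₂
  · refine ⟨e₁, ?_⟩
    rw [hz₂, ← mem_incidenceSet, Set.pair_comm, Equiv.swap_comm, incidenceSet_moveEnds_swap h₁₁ h₂₁]
    exact Set.mem_insert _ _
  · exact (hG z hz).imp fun e => (moveEnds_swap_inc_of_ne hz₁ hz₂).2

theorem IsVertexConnected.not_stronglyIsomorphic_moveEnds_swap [DecidableEq α]
    (hG : IsVertexConnected 3 G) (hne : x₁ ≠ x₂)
    (h₁₁ : G.Inc e₁ x₁) (h₁₂ : ¬ G.Inc e₁ x₂) (h₂₁ : ¬ G.Inc e₂ x₁) :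
    ¬ StronglyIsomorphic G (moveEnds G {e₁, e₂} (Equiv.swap x₁ x₂)) := by
  intro hiso
  obtain ⟨y, hxy⟩ := h₁₁
  obtain ⟨x', hx'⟩ := hiso.exists_incidenceSet_eq hxy.left_mem
  obtain ⟨f, z, hf, hzx₁, hzD⟩ := hG.exists_isLink_notMem hxy.left_mem (D := {x₂, y})
    ((Set.encard_insert_le _ _).trans_lt (by rw [Set.encard_singleton]; norm_num))
  rw [Set.mem_insert_iff, Set.mem_singleton_iff, not_or] at hzD
  have hfD : f ∉ ({e₁, e₂} : Set β) := by
    rintro (rfl | rfl)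
    · exact (hf.inc_right.eq_or_eq_of_isLink hxy).elim hzx₁ hzD.2
    · exact h₂₁ hf.inc_left
  have hx'f : x' = x₁ ∨ x' = z :=
    ((moveEnds_inc_of_notMem hfD).1 (hx'.superset hf.inc_left)).eq_or_eq_of_isLink hf
  obtain ⟨a, ha, rfl⟩ := (moveEnds_inc_of_mem (by simp)).1 (hx'.superset hxy.inc_left)
  have hax₂ : a ≠ x₂ := fun h => h₁₂ (h ▸ ha)
  rcases eq_or_ne a x₁ with rfl | hax₁
  · rw [Equiv.swap_apply_left] at hx'f
    exact hx'f.elim hne.symm fun h => hzD.1 h.symm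
  · rw [Equiv.swap_apply_of_ne_of_ne hax₁ hax₂] at hx'f
    have hay : a = y := (ha.eq_or_eq_of_isLink hxy).resolve_left hax₁
    exact hx'f.elim hax₁ fun h => hzD.2 (h.symm.trans hay)

theorem IsVertexConnected.not_uniquelyDefined_of_ne (hG : IsVertexConnected 3 G)
    (hx₁ : x₁ ∈ V(G)) (hx₂ : x₂ ∈ V(G)) (hne : x₁ ≠ x₂)
    (hexc₁ : excess (G.deleteVerts {x₁}) < k) (hexc₂ : excess (G.deleteVerts {x₂}) < k) :
    ¬ UniquelyDefined G hE k hk := by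
  classical
  intro hU
  have hconn := hG.isConnected three_pos
  obtain ⟨e₁, y₁, hxy₁, -, hyx₁₂⟩ := hG.exists_isLink_notMem hx₁ (D := {x₂}) (by simp)
  obtain ⟨e₂, y₂, hxy₂, -, hyx₂₁⟩ := hG.exists_isLink_notMem hx₂ (D := {x₁}) (by simp)
  have h₁₂ : ¬ G.Inc e₁ x₂ := fun h =>
    (h.eq_or_eq_of_isLink hxy₁).elim hne.symm fun h => hyx₁₂ h.symm
  have h₂₁ : ¬ G.Inc e₂ x₁ := fun h =>
    (h.eq_or_eq_of_isLink hxy₂).elim hne fun h => hyx₂₁ h.symm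
  refine hG.not_stronglyIsomorphic_moveEnds_swap hne hxy₁.inc_left h₁₂ h₂₁ (hU α _ ?_ hE ?_ ?_)
  · rw [vertexSet_moveEnds (mapsTo_swap hx₁ hx₂)]
    exact hconn.finite_vertexSet hE
  · exact (hconn.noIsolatedVertex ⟨e₁, hxy₁.edge_mem⟩).moveEnds_swap hxy₁.inc_left h₁₂ h₂₁
      hxy₂.inc_left
  · exact hG.kCircularMatroid_moveEnds_swap hxy₁.inc_left h₁₂ h₂₁ hxy₂.inc_left hexc₁ hexc₂

end Swap

section Characterization

theorem IsThreeConnected.uniquelyDefined_iff (hG : IsThreeConnected G) :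
    UniquelyDefined G hE k hk ↔ (∀ x ∈ V(G), (k : ℤ) ≤ excess (G.deleteVerts {x}) + 1) ∧
      {x ∈ V(G) | excess (G.deleteVerts {x}) < k}.Subsingleton := by
  have : G.Loopless := hG.1
  have hG₃ := hG.isVertexConnected
  refine ⟨fun hU => ⟨fun x hx => ?_, fun x hx y hy => ?_⟩, fun h => hG₃.uniquelyDefined h.1 h.2⟩
  · by_contra! hlt
    exact (hG₃.mono (by norm_num)).not_uniquelyDefined_of_excess_add_one_lt hx hlt hU
  · by_contra hne
    exact hG₃.not_uniquelyDefined_of_ne hx.1 hy.1 hne hx.2 hy.2 hU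

theorem forall_le_or_exists_add_one_eq_iff {ι : Type*} {s : Set ι} {f : ι → ℤ} {m : ℤ} :
    ((∀ x ∈ s, m ≤ f x) ∨ ∃ t ∈ s, f t + 1 = m ∧ ∀ x ∈ s, x ≠ t → m ≤ f x) ↔
      (∀ x ∈ s, m ≤ f x + 1) ∧ {x ∈ s | f x < m}.Subsingleton := by
  constructor
  · rintro (h | ⟨t, -, htm, h⟩)
    · exact ⟨fun x hx => by linarith [h x hx], fun x hx => absurd (h x hx.1) hx.2.not_ge⟩
    · refine ⟨fun x hx => ?_, Set.subsingleton_of_forall_eq t fun x hx => ?_⟩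
      · rcases eq_or_ne x t with rfl | hxt
        exacts [htm.ge, by linarith [h x hx hxt]]
      · by_contra hxt
        exact hx.2.not_ge (h x hx.1 hxt)
  · rintro ⟨hle, hsub⟩
    refine or_iff_not_imp_left.2 fun hnot => ?_
    push Not at hnot
    obtain ⟨t, hts, htm⟩ := hnot
    refine ⟨t, hts, by linarith [hle t hts, Int.add_one_le_iff.2 htm], fun x hx hxt => ?_⟩
    exact not_lt.1 fun hxm => hxt (hsub ⟨hx, hxm⟩ ⟨hts, htm⟩)

end Characterization

end KCircular

theorem mainTheorem1 {α : Type u} {β : Type v} (G : Graph α β) (hV : V(G).Finite)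
    (hE : E(G).Finite) (hG : KCircular.IsThreeConnected G) (k : ℕ) (hk : 1 ≤ k) :
    KCircular.UniquelyDefined G hE k hk ↔
      ((k : ℤ) ≤ (E(G).ncard : ℤ) - (V(G).ncard : ℤ) ∧
        ((∀ x ∈ V(G), KCircular.IsKSmall G hE k hk x) ∨
          ∃ t ∈ V(G), KCircular.IsKTight G hE k hk t ∧
            ∀ x ∈ V(G), x ≠ t → KCircular.IsKSmall G hE k hk x)) := by
  have hG₂ : KCircular.IsVertexConnected 2 G := hG.isVertexConnected.mono (by norm_num)
  have hconn := hG₂.isConnected two_pos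
  refine hG.uniquelyDefined_iff.trans <|
    (and_iff_right_of_imp fun h => hG₂.le_excess hE h.1).symm.trans <|
      and_congr_right fun hexc => ?_
  have hsmall (x : α) (hx : x ∈ V(G)) := hconn.isKSmall_iff (hE := hE) (hk := hk)
    (hexc.trans (Int.le_add_one le_rfl)) hx
  have htight (x : α) (hx : x ∈ V(G)) := hconn.isKTight_iff (hE := hE) (hk := hk)
    (hexc.trans (Int.le_add_one le_rfl)) hx
  rw [← KCircular.forall_le_or_exists_add_one_eq_iff]
  exact (or_congr (forall₂_congr hsmall) (exists_congr fun t => and_congr_right fun ht =>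
    and_congr (htight t ht) (forall₂_congr fun x hx => imp_congr_right fun _ => hsmall x hx))).symm
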